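/- \textbf{Setting.} Let $\nu$ be a $\sigma$-finite measure on a measurable space $\mathcal Y$ (e.g. Lebesgue or counting measure on a subset of $\mathbb R^d$); write $dy$ for $\nu(dy)$. Let $f(y|\theta)\ge 0$, $\theta\in\mathbb R^p$, be measurable in $y$ with $C(\theta)=\int f(y|\theta)\,dy<\infty$, and consider the model $p(y|\theta)=f(y|\theta)/C(\theta)$. Let $g$ and $h$ be probability densities with respect to $\nu$ such that for $g$-almost every $y$ one has $f(y|\theta)>0$ for all $\theta$, and such that for each $\theta$, $f(y|\theta)=0$ for almost every $y$ with $h(y)=0$. The density $g$ need not belong to the model. Let $\theta_\star$ be a maximizer of $\theta\mapsto\mathbb E_{Y\sim g}\log p(Y|\theta)$ over $\mathbb R^p$, the maximum being finite (the value $-\infty$ is allowed at other $\theta$). Let $Y_1,Y_2,\dots$ be i.i.d. from $g$ and let $Y^1,Y^2,\dots$ be i.i.d. from $h$, independent of $(Y_i)$. Put $$C_m(\theta)=\frac1m\sum_{k=1}^m\frac{f(Y^k|\theta)}{h(Y^k)},\qquad \bar\ell_n(\theta)=\frac1n\sum_{i=1}^n\bigl[\log f(Y_i|\theta)-\log C(\theta)\bigr],\qquad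 \bar\ell_n^m(\theta)=\frac1n\sum_{i=1}^n\log f(Y_i|\theta)-\log C_m(\theta).$$ Let the random vector $\hat\theta_n^m$ be a maximizer of $\bar\ell_n^m$ over $\mathbb R^p$, with probability tending to one as $n,m\to\infty$. Derivatives $\nabla,\nabla^2$ are with respect to $\theta$. \textbf{Theorem.} For some $\delta>0$ let $U=\{\theta:|\theta-\theta_\star|\le\delta\}$. Assume: \begin{enumerate} \item for every $y$ the second partial derivatives of $f(y|\theta)$ in $\theta$ exist and are continuous, and the first and second derivatives can be passed under the integral sign in $\int f(y|\theta)\,dy$; \item $\sqrt{\min(n,m)}\,(\hat\theta_n^m-\theta_\star)=O_p(1)$ as $n,m\to\infty$; \item the matrices $$V=\mathrm{VAR}_{Y\sim g}\nabla\log p(Y|\theta_\star),\quad D=\mathbb E_{Y\sim g}\nabla^2\log p(Y|\theta_\star),\quad W=\frac1{C(\theta_\star)^2}\mathrm{VAR}_{Y\sim h}\left[\frac{\nabla f(Y|\theta_\star)}{h(Y)}-\frac{\nabla C(\theta_\star)}{C(\theta_\star)}\frac{f(Y|\theta_\star)}{h(Y)}\right]$$ exist (second moments, respectively first moments, are finite),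 $V$ is positive definite and $D$ is negative definite; \item $D(\theta)=\mathbb E_{Y\sim g}\nabla^2\log p(Y|\theta)$ exists for $\theta\in U$ and is continuous at $\theta_\star$; \item $\sup_{\theta\in U}|\nabla^2\bar\ell_n(\theta)-D(\theta)|\to 0$ in probability as $n\to\infty$; \item $\sup_{\theta\in U}|\nabla^2C_m(\theta)-\nabla^2C(\theta)|\to 0$ in probability as $m\to\infty$. \end{enumerate} (In 5 and 6, convergence is in outer probability if the supremum is not measurable.) Then $$\left(\frac Vn+\frac Wm\right)^{-1/2}D\,\bigl(\hat\theta_n^m-\theta_\star\bigr)\to\mathcal N(0,I)\quad\text{in distribution, as } n,m\to\infty \text{ at arbitrary rates}.$$ -/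

import Mathlib

open MeasureTheory ProbabilityTheory Filter Topology
open scoped MatrixOrder ENNReal

namespace MCML

noncomputable section

/-- The parameter space `ℝ^p` with its Euclidean structure. -/
abbrev Param (p : ℕ) : Type := EuclideanSpace ℝ (Fin p)

/-- The Hessian matrix: the Jacobian matrix of the gradient. -/
def hess {p : ℕ} (F : Param p → ℝ) (θ : Param p) : Matrix (Fin p) (Fin p) ℝ :=
  Matrix.of fun i j => (fderiv ℝ (gradient F) θ (EuclideanSpace.single j 1)) i

/-- The Euclidean (Frobenius) norm `|A|` of a matrix. -/
def matNorm {p : ℕ} (A : Matrix (Fin p) (Fin p) ℝ) : ℝ :=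
  √(∑ i, ∑ j, A i j ^ 2)

/-- The inverse square root `A^{-1/2}` of a positive definite matrix. -/
def invSqrt {p : ℕ} (A : Matrix (Fin p) (Fin p) ℝ) : Matrix (Fin p) (Fin p) ℝ :=
  (CFC.sqrt A)⁻¹

/-- The variance-covariance matrix of a random vector. -/
def covMat {S : Type*} [MeasurableSpace S] {p : ℕ} (X : S → Param p) (μ : Measure S) :
    Matrix (Fin p) (Fin p) ℝ :=
  Matrix.of fun i j => covariance (fun y => X y i) (fun y => X y j) μ

section Model

variable {S : Type*} [MeasurableSpace S] {p : ℕ}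

/-- `q` is a probability density with respect to `ν`. -/
structure IsDensity (ν : Measure S) (q : S → ℝ) : Prop where
  measurable : Measurable q
  nonneg : ∀ y, 0 ≤ q y
  lintegral_eq_one : ∫⁻ y, ENNReal.ofReal (q y) ∂ν = 1

/-- The distribution with density `q` with respect to `ν`. -/
def law (ν : Measure S) (q : S → ℝ) : Measure S :=
  ν.withDensity fun y => ENNReal.ofReal (q y)

/-- The norming constant `C(θ) = ∫ f(y|θ) dy`. -/
def normConst (ν : Measure S) (f : S → Param p → ℝ) (θ : Param p) : ℝ :=
  ∫ y, f y θ ∂ν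

/-- The log-density `log p(y|θ) = log f(y|θ) - log C(θ)` of the model. -/
def logDensity (ν : Measure S) (f : S → Param p → ℝ) (y : S) (θ : Param p) : ℝ :=
  Real.log (f y θ) - Real.log (normConst ν f θ)

/-- The integral defining `C` converges, and first and second derivatives with respect to `θ`
pass under the integral sign. -/
structure DiffUnderIntegral (ν : Measure S) (f : S → Param p → ℝ) : Prop where
  integrable : ∀ θ, Integrable (fun y => f y θ) ν
  integrable_gradient : ∀ θ, Integrable (fun y => gradient (f y) θ) ν
  hasGradientAt : ∀ θ, HasGradientAt (normConst ν f) (∫ y, gradient (f y) θ ∂ν) θ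
  integrable_second : ∀ θ, Integrable (fun y => fderiv ℝ (gradient (f y)) θ) ν
  hasFDerivAt_gradient : ∀ θ,
    HasFDerivAt (gradient (normConst ν f)) (∫ y, fderiv ℝ (gradient (f y)) θ ∂ν) θ

/-- `θs` maximizes `θ ↦ E_{Y ∼ g} log p(Y|θ)`. The maximum is finite; the expectation at other
parameters is allowed to be `-∞` (positive part integrable, but the function not). -/
structure IsKLProjection (ν : Measure S) (f : S → Param p → ℝ) (g : S → ℝ) (θs : Param p) :
    Prop where
  integrable_at : Integrable (fun y => logDensity ν f y θs) (law ν g)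
  integrable_posPart : ∀ θ, Integrable (fun y => max (logDensity ν f y θ) 0) (law ν g)
  le : ∀ θ, Integrable (fun y => logDensity ν f y θ) (law ν g) →
    ∫ y, logDensity ν f y θ ∂(law ν g) ≤ ∫ y, logDensity ν f y θs ∂(law ν g)

/-- `V = VAR_{Y ∼ g} ∇ log p(Y|θs)`. -/
def matV (ν : Measure S) (f : S → Param p → ℝ) (g : S → ℝ) (θs : Param p) :
    Matrix (Fin p) (Fin p) ℝ :=
  covMat (fun y => gradient (logDensity ν f y) θs) (law ν g)

/-- `D(θ) = E_{Y ∼ g} ∇² log p(Y|θ)`. -/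
def matD (ν : Measure S) (f : S → Param p → ℝ) (g : S → ℝ) (θ : Param p) :
    Matrix (Fin p) (Fin p) ℝ :=
  Matrix.of fun i j => ∫ y, hess (logDensity ν f y) θ i j ∂(law ν g)

/-- The vector `∇f(y|θ)/h(y) - (∇C(θ)/C(θ)) f(y|θ)/h(y)`. -/
def mcScore (ν : Measure S) (f : S → Param p → ℝ) (h : S → ℝ) (θ : Param p) (y : S) : Param p :=
  (h y)⁻¹ • gradient (f y) θ -
    (f y θ / h y) • ((normConst ν f θ)⁻¹ • gradient (normConst ν f) θ)

/-- `W = C(θs)^{-2} VAR_{Y ∼ h} [∇f(Y|θs)/h(Y) - (∇C(θs)/C(θs)) f(Y|θs)/h(Y)]`. -/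
def matW (ν : Measure S) (f : S → Param p → ℝ) (h : S → ℝ) (θs : Param p) :
    Matrix (Fin p) (Fin p) ℝ :=
  (1 / normConst ν f θs ^ 2) • covMat (mcScore ν f h θs) (law ν h)

/-- The Monte Carlo approximation `C_m(θ)` from the points `z 0, …, z (m - 1)`. -/
def mcConst (f : S → Param p → ℝ) (h : S → ℝ) (m : ℕ) (z : ℕ → S) (θ : Param p) : ℝ :=
  (1 / (m : ℝ)) * ∑ k ∈ Finset.range m, f (z k) θ / h (z k)

/-- The normalized log-likelihood of the observations `y 0, …, y (n - 1)`. -/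
def logLik (ν : Measure S) (f : S → Param p → ℝ) (n : ℕ) (y : ℕ → S) (θ : Param p) : ℝ :=
  (1 / (n : ℝ)) * ∑ i ∈ Finset.range n,
    (Real.log (f (y i) θ) - Real.log (normConst ν f θ))

/-- The Monte Carlo approximation of the normalized log-likelihood. -/
def mcLogLik (f : S → Param p → ℝ) (h : S → ℝ) (n m : ℕ) (y z : ℕ → S) (θ : Param p) : ℝ :=
  (1 / (n : ℝ)) * (∑ i ∈ Finset.range n, Real.log (f (y i) θ)) - Real.log (mcConst f h m z θ)

end Model

/-- `sup_{θ ∈ U} |A_n(θ) - B(θ)| → 0` in probability (in outer probability if the supremum is not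
measurable). The supremum is taken in `[0, ∞]`. -/
def UnifTendstoInProb {Ω : Type*} [MeasurableSpace Ω] (P : Measure Ω) {p : ℕ} (U : Set (Param p))
    (A : ℕ → Ω → Param p → Matrix (Fin p) (Fin p) ℝ)
    (B : Param p → Matrix (Fin p) (Fin p) ℝ) : Prop :=
  ∀ ε : ℝ≥0∞, 0 < ε →
    Tendsto (fun n => P {ω | ε ≤ ⨆ θ ∈ U, ENNReal.ofReal (matNorm (A n ω θ - B θ))})
      atTop (𝓝 0)

/-- `X_{n,m} = O_p(1)` as `n, m → ∞`. -/
def BoundedInProb {Ω : Type*} [MeasurableSpace Ω] (P : Measure Ω) {p : ℕ}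
    (X : ℕ × ℕ → Ω → Param p) : Prop :=
  ∀ ε : ℝ≥0∞, 0 < ε → ∃ M : ℝ, ∀ᶠ nm in (atTop : Filter (ℕ × ℕ)),
    P {ω | M < ‖X nm ω‖} ≤ ε

end

end MCML

/-! Write Σ = V/n + W/m. With probability tending to one the gradient of the Monte Carlo
log-likelihood vanishes at θ̂. Expanding it at θ⋆ gives D(θ̂ − θ⋆) = −∇ℓ(θ⋆) − R with R = o(|θ̂ −
θ⋆|). By `gradient_mcLogLik`, ∇ℓ(θ⋆) is the average of the model scores at the Y_i minus C/C_m times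
the average of centred Monte Carlo scores with covariance W, and C/C_m → 1. Up to negligible terms,
D(θ̂ − θ⋆) is thus a difference of two independent centred averages with total covariance Σ.

Arbitrary rates are possible because positive definiteness of V and W gives |Σ^{-1/2}t| ≤ K
√min(n,m) |t| (`exists_norm_pooledInvSqrt_le`). After division by √n or √m these vectors stay
bounded. Characteristic functions of normalized sums are close to Gaussian ones uniformly on bounded
sets (`tendsto_charFun_normSum_sub`), and the two Gaussian factors multiply to exp(−|t|²/2) exactly,
whatever n/m does; this is `tendstoInDistribution_standardizedDiff`. The same operator bound, with
the assumed rate of θ̂, makes Σ^{-1/2}R negligible.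

Three facts have to be derived from the hypotheses: the mean score at θ⋆ is zero
(`integral_score_eq_zero`), W is positive definite (`posDef_matW`), and ∇²C is continuous at θ⋆
(`tendsto_fderiv_gradient_mcConst`).

Convergence in probability is convergence along `probFilter`, and its product with the neighbourhood
filter of θ⋆ expresses uniformity near θ⋆. Limit theorems for filters then apply directly, and
suprema need not be measurable. -/

namespace MCML

/-! ### Convergence and boundedness in probability through filters -/

section ProbFilter

variable {ι κ Ω : Type*} [MeasurableSpace Ω] {P : Measure Ω} {l : Filter ι}

/-- The filter of families of events whose (outer) probability tends to one along `l`. -/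
def probFilter (P : Measure Ω) (l : Filter ι) : Filter (ι × Ω) where
  sets := {A | Tendsto (fun i => P {ω | (i, ω) ∉ A}) l (𝓝 0)}
  univ_sets := by simpa using tendsto_const_nhds
  sets_of_superset {A B} hA hAB :=
    tendsto_of_tendsto_of_tendsto_of_le_of_le tendsto_const_nhds hA (fun _ => zero_le)
      fun i => measure_mono fun ω (hω : (i, ω) ∉ B) => fun h => hω (hAB h)
  inter_sets {A B} hA hB := by
    have h := Tendsto.add hA hB
    rw [add_zero] at h
    refine tendsto_of_tendsto_of_tendsto_of_le_of_le tendsto_const_nhds h (fun _ => zero_le)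
      fun i => (measure_mono fun ω (hω : (i, ω) ∉ A ∩ B) => ?_).trans (measure_union_le _ _)
    by_cases hA' : (i, ω) ∈ A
    · exact Or.inr fun hB' => hω ⟨hA', hB'⟩
    · exact Or.inl hA'

lemma eventually_probFilter {q : ι × Ω → Prop} :
    (∀ᶠ x in probFilter P l, q x) ↔ Tendsto (fun i => P {ω | ¬ q (i, ω)}) l (𝓝 0) :=
  Iff.rfl

lemma tendsto_fst_probFilter_index : Tendsto Prod.fst (probFilter P l) l := by
  intro s hs
  refine tendsto_const_nhds.congr' ?_
  filter_upwards [hs] with i hi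
  simp [hi]

lemma eventually_probFilter_of_ae {q : Ω → Prop} (h : ∀ᵐ ω ∂P, q ω) :
    ∀ᶠ x in probFilter P l, q x.2 := by
  rw [eventually_probFilter]
  have : (fun _ : ι => P {ω | ¬ q ω}) = fun _ => 0 := funext fun _ => h
  rw [this]
  exact tendsto_const_nhds

/-- Carries limits in n alone or in m alone over to the joint index (n, m). -/
lemma tendsto_map_probFilter {l' : Filter κ} {u : ι → κ} (hu : Tendsto u l l') :
    Tendsto (fun x : ι × Ω => (u x.1, x.2)) (probFilter P l) (probFilter P l') :=
  fun s hs => by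
    have hs' : Tendsto (fun i => P {ω | (i, ω) ∉ s}) l' (𝓝 0) := hs
    exact hs'.comp hu

/-- The empty event has probability zero, not close to one. This allows deterministic inequalities
to be read off from random ones, as in `integral_score_eq_zero`. -/
instance probFilter_neBot [IsProbabilityMeasure P] [l.NeBot] : (probFilter P l).NeBot := by
  refine ⟨fun h => ?_⟩
  have h0 : ∀ᶠ _ in probFilter P l, False := by rw [h]; trivial
  rw [eventually_probFilter] at h0
  simp only [not_false_eq_true, Set.ofPred_true, measure_univ] at h0
  exact one_ne_zero (tendsto_nhds_unique tendsto_const_nhds h0)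

lemma tendsto_probFilter_iff {E : Type*} [PseudoMetricSpace E] {X : ι → Ω → E} {c : E} :
    Tendsto (fun x : ι × Ω => X x.1 x.2) (probFilter P l) (𝓝 c) ↔
      TendstoInMeasure P X l fun _ => c := by
  rw [tendstoInMeasure_iff_dist, Metric.tendsto_nhds]
  refine forall₂_congr fun ε _ => ?_
  rw [eventually_probFilter]
  simp only [not_lt]

/-- The real random variables `X i` are bounded in probability along `l`. -/
def TightAlong (P : Measure Ω) (l : Filter ι) (X : ι → Ω → ℝ) : Prop :=
  ∀ ε : ℝ≥0∞, 0 < ε → ∃ M : ℝ, ∀ᶠ i in l, P {ω | M < X i ω} ≤ ε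

/-- The rule o_p(1) · O_p(1) = o_p(1). -/
lemma TightAlong.tendsto_mul {X : ι → Ω → ℝ} (hX : TightAlong P l X) (hX0 : ∀ i ω, 0 ≤ X i ω)
    {a : ι × Ω → ℝ} (ha : Tendsto a (probFilter P l) (𝓝 0)) :
    Tendsto (fun x => a x * X x.1 x.2) (probFilter P l) (𝓝 0) := by
  rw [Metric.tendsto_nhds]
  intro ε hε
  rw [eventually_probFilter, ENNReal.tendsto_nhds_zero]
  intro η hη
  obtain ⟨M, hM⟩ := hX (η / 2) (ENNReal.half_pos hη.ne')
  have hK : 0 < ε / (|M| + 1) := by positivity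
  have h1 := Metric.tendsto_nhds.1 ha _ hK
  rw [eventually_probFilter, ENNReal.tendsto_nhds_zero] at h1
  filter_upwards [hM, h1 (η / 2) (ENNReal.half_pos hη.ne')] with i hi1 hi2
  calc _ ≤ P ({ω | M < X i ω} ∪ {ω | ¬ dist (a (i, ω)) 0 < ε / (|M| + 1)}) := by
        refine measure_mono fun ω hω => ?_
        by_contra hcon
        simp only [Set.mem_union, Set.mem_ofPred_eq, not_or, not_lt, not_le, dist_zero_right,
          Real.norm_eq_abs] at hcon hω
        obtain ⟨h2, h3⟩ := hcon
        rw [abs_mul, abs_of_nonneg (hX0 i ω)] at hω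
        have h4 : X i ω ≤ |M| := h2.trans (le_abs_self M)
        rw [lt_div_iff₀ (by positivity)] at h3
        nlinarith [abs_nonneg (a (i, ω)), hX0 i ω]
    _ ≤ η / 2 + η / 2 := (measure_union_le _ _).trans (add_le_add hi1 hi2)
    _ = η := ENNReal.add_halves η

lemma TightAlong.comp {X : ι → Ω → ℝ} (hX : TightAlong P l X) {l' : Filter κ} {u : κ → ι}
    (hu : Tendsto u l' l) : TightAlong P l' fun k => X (u k) := fun ε hε => by
  obtain ⟨M, hM⟩ := hX ε hε
  exact ⟨M, hu.eventually hM⟩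

/-- Markov's inequality. -/
lemma tightAlong_of_integral_le {X : ι → Ω → ℝ} {K : ℝ} (hX0 : ∀ i ω, 0 ≤ X i ω)
    (hXi : ∀ i, Integrable (X i) P) (hK : ∀ i, ∫ ω, X i ω ∂P ≤ K) : TightAlong P l X := by
  intro ε hε
  by_cases hεt : ε = ⊤
  · exact ⟨0, by simp [hεt]⟩
  have hε' : 0 < ε.toReal := ENNReal.toReal_pos hε.ne' hεt
  -- The quotient makes Markov's bound |K|/M at most ε; the 1 keeps M positive when K = 0.
  refine ⟨max 1 (|K| / ε.toReal), Eventually.of_forall fun i => ?_⟩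
  set M := max 1 (|K| / ε.toReal)
  have hM : 0 < M := lt_of_lt_of_le one_pos (le_max_left _ _)
  calc P {ω | M < X i ω} ≤ P {ω | ENNReal.ofReal M ≤ ENNReal.ofReal (X i ω)} :=
        measure_mono fun ω hω => ENNReal.ofReal_le_ofReal (le_of_lt hω)
    _ ≤ (∫⁻ ω, ENNReal.ofReal (X i ω) ∂P) / ENNReal.ofReal M :=
        meas_ge_le_lintegral_div (hXi i).1.aemeasurable.ennreal_ofReal
          (by simpa using hM) ENNReal.ofReal_ne_top
    _ ≤ ENNReal.ofReal |K| / ENNReal.ofReal M := by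
        gcongr
        rw [← ofReal_integral_eq_lintegral_ofReal (hXi i) (Eventually.of_forall (hX0 i))]
        exact ENNReal.ofReal_le_ofReal ((hK i).trans (le_abs_self K))
    _ = ENNReal.ofReal (|K| / M) := (ENNReal.ofReal_div_of_pos hM).symm
    _ ≤ ENNReal.ofReal ε.toReal := by
        refine ENNReal.ofReal_le_ofReal ?_
        rw [div_le_iff₀ hM, mul_comm, ← div_le_iff₀ hε']
        exact le_max_right _ _
    _ = ε := ENNReal.ofReal_toReal hεt

end ProbFilter

/-! ### First-order expansions uniform over a filter of functions -/

section MeanValue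

variable {X E F : Type*} [NormedAddCommGroup E] [NormedSpace ℝ E]
  [NormedAddCommGroup F] [NormedSpace ℝ F] {𝓕 : Filter X} {G : X → E → F} {θs : E} {L : E →L[ℝ] F}

/-- Uniform first-order expansion at `θs` of functions whose derivatives converge near `θs`. -/
lemma eventually_norm_sub_sub_le_of_tendsto_fderiv
    (hd : ∀ᶠ x in 𝓕 ×ˢ 𝓝 θs, DifferentiableAt ℝ (G x.1) x.2)
    (hL : Tendsto (fun x : X × E => fderiv ℝ (G x.1) x.2) (𝓕 ×ˢ 𝓝 θs) (𝓝 L))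
    {ε : ℝ} (hε : 0 < ε) :
    ∀ᶠ x in 𝓕 ×ˢ 𝓝 θs, ‖G x.1 x.2 - G x.1 θs - L (x.2 - θs)‖ ≤ ε * ‖x.2 - θs‖ := by
  have h := hd.and ((Metric.tendsto_nhds.1 hL) ε hε)
  obtain ⟨p, hp, q, hq, hpq⟩ := eventually_prod_iff.1 h
  obtain ⟨r, hr, hball⟩ := Metric.eventually_nhds_iff_ball.1 hq
  refine eventually_prod_iff.2 ⟨p, hp, fun θ => θ ∈ Metric.ball θs r,
    Metric.ball_mem_nhds θs hr, fun {x} hx {θ} hθ => ?_⟩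
  -- Mean value inequality on a ball where every derivative is within ε of L.
  refine (convex_ball θs r).norm_image_sub_le_of_norm_hasFDerivWithin_le'
    (f' := fun θ => fderiv ℝ (G x) θ) (fun y hy => ?_) (fun y hy => ?_)
    (Metric.mem_ball_self hr) hθ
  · exact (hpq hx (hball y hy)).1.hasFDerivAt.hasFDerivWithinAt
  · rw [← dist_eq_norm]
    exact (hpq hx (hball y hy)).2.le

/-- Convergent derivatives near a point and convergent values at the point give joint convergence.
Applied first to gradients and then to values, it descends from Hessians to the functions
themselves. -/
lemma tendsto_prod_nhds_of_tendsto_fderiv {c : F}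
    (hd : ∀ᶠ x in 𝓕 ×ˢ 𝓝 θs, DifferentiableAt ℝ (G x.1) x.2)
    (hL : Tendsto (fun x : X × E => fderiv ℝ (G x.1) x.2) (𝓕 ×ˢ 𝓝 θs) (𝓝 L))
    (hc : Tendsto (fun x => G x θs) 𝓕 (𝓝 c)) :
    Tendsto (fun x : X × E => G x.1 x.2) (𝓕 ×ˢ 𝓝 θs) (𝓝 c) := by
  have hθ : Tendsto (fun x : X × E => x.2 - θs) (𝓕 ×ˢ 𝓝 θs) (𝓝 0) := by
    simpa using (tendsto_snd (f := 𝓕) (g := 𝓝 θs)).sub_const θs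
  have h1 : Tendsto (fun x : X × E => G x.1 x.2 - G x.1 θs - L (x.2 - θs)) (𝓕 ×ˢ 𝓝 θs) (𝓝 0) := by
    refine squeeze_zero_norm' (eventually_norm_sub_sub_le_of_tendsto_fderiv hd hL one_pos) ?_
    simpa using hθ.norm
  have h2 : Tendsto (fun x : X × E => L (x.2 - θs)) (𝓕 ×ˢ 𝓝 θs) (𝓝 0) := by
    have h3 := (L.continuous.tendsto 0).comp hθ
    rwa [map_zero] at h3
  simpa using (h1.add h2).add (hc.comp tendsto_fst)

end MeanValue

/-! ### Calculus of gradients and second derivatives, in particular of logarithms -/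

section Gradient

variable {E : Type*} [NormedAddCommGroup E] [InnerProductSpace ℝ E] [CompleteSpace E]
  {F G : E → ℝ} {θ v w : E}

lemma _root_.HasGradientAt.add (hF : HasGradientAt F v θ) (hG : HasGradientAt G w θ) :
    HasGradientAt (fun x => F x + G x) (v + w) θ := by
  rw [hasGradientAt_iff_hasFDerivAt, map_add]
  exact hF.hasFDerivAt.add hG.hasFDerivAt

lemma _root_.HasGradientAt.sub (hF : HasGradientAt F v θ) (hG : HasGradientAt G w θ) :
    HasGradientAt (fun x => F x - G x) (v - w) θ := by
  rw [hasGradientAt_iff_hasFDerivAt, map_sub]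
  exact hF.hasFDerivAt.sub hG.hasFDerivAt

lemma _root_.HasGradientAt.const_mul (c : ℝ) (hF : HasGradientAt F v θ) :
    HasGradientAt (fun x => c * F x) (c • v) θ := by
  rw [hasGradientAt_iff_hasFDerivAt, map_smul]
  exact hF.hasFDerivAt.const_mul c

lemma _root_.HasGradientAt.sum {κ : Type*} {s : Finset κ} {F : κ → E → ℝ} {v : κ → E}
    (hF : ∀ k ∈ s, HasGradientAt (F k) (v k) θ) :
    HasGradientAt (fun x => ∑ k ∈ s, F k x) (∑ k ∈ s, v k) θ := by
  rw [hasGradientAt_iff_hasFDerivAt, map_sum]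
  exact HasFDerivAt.fun_sum fun k hk => (hF k hk).hasFDerivAt

lemma _root_.HasGradientAt.log (hF : HasGradientAt F v θ) (h0 : F θ ≠ 0) :
    HasGradientAt (fun x => Real.log (F x)) ((F θ)⁻¹ • v) θ := by
  rw [hasGradientAt_iff_hasFDerivAt, map_smul]
  exact hF.hasFDerivAt.log h0

/-- `F` is differentiable near `θ` with gradient differentiable at `θ`. -/
structure TwiceDiffAt (F : E → ℝ) (θ : E) : Prop where
  diff : ∀ᶠ x in 𝓝 θ, DifferentiableAt ℝ F x
  diff_gradient : DifferentiableAt ℝ (gradient F) θ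

lemma TwiceDiffAt.hasGradientAt (hF : TwiceDiffAt F θ) : HasGradientAt F (gradient F θ) θ :=
  hF.diff.self_of_nhds.hasGradientAt

lemma TwiceDiffAt.gradient_add (hF : TwiceDiffAt F θ) (hG : TwiceDiffAt G θ) :
    gradient (fun x => F x + G x) =ᶠ[𝓝 θ] fun x => gradient F x + gradient G x := by
  filter_upwards [hF.diff, hG.diff] with x hx hy
  exact (hx.hasGradientAt.add hy.hasGradientAt).gradient

lemma TwiceDiffAt.gradient_sub (hF : TwiceDiffAt F θ) (hG : TwiceDiffAt G θ) :
    gradient (fun x => F x - G x) =ᶠ[𝓝 θ] fun x => gradient F x - gradient G x := by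
  filter_upwards [hF.diff, hG.diff] with x hx hy
  exact (hx.hasGradientAt.sub hy.hasGradientAt).gradient

lemma TwiceDiffAt.gradient_const_mul (c : ℝ) (hF : TwiceDiffAt F θ) :
    gradient (fun x => c * F x) =ᶠ[𝓝 θ] fun x => c • gradient F x := by
  filter_upwards [hF.diff] with x hx
  exact (hx.hasGradientAt.const_mul c).gradient

lemma TwiceDiffAt.eventually_ne (hF : TwiceDiffAt F θ) (h0 : F θ ≠ 0) : ∀ᶠ x in 𝓝 θ, F x ≠ 0 :=
  hF.diff.self_of_nhds.continuousAt.eventually_ne h0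

lemma TwiceDiffAt.gradient_log (hF : TwiceDiffAt F θ) (h0 : F θ ≠ 0) :
    gradient (fun x => Real.log (F x)) =ᶠ[𝓝 θ] fun x => (F x)⁻¹ • gradient F x := by
  filter_upwards [hF.diff, hF.eventually_ne h0] with x hx hx0
  exact (hx.hasGradientAt.log hx0).gradient

lemma TwiceDiffAt.add (hF : TwiceDiffAt F θ) (hG : TwiceDiffAt G θ) :
    TwiceDiffAt (fun x => F x + G x) θ where
  diff := by
    filter_upwards [hF.diff, hG.diff] with x hx hy using hx.add hy
  diff_gradient := (hF.diff_gradient.add hG.diff_gradient).congr_of_eventuallyEq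
    (hF.gradient_add hG)

lemma TwiceDiffAt.sub (hF : TwiceDiffAt F θ) (hG : TwiceDiffAt G θ) :
    TwiceDiffAt (fun x => F x - G x) θ where
  diff := by
    filter_upwards [hF.diff, hG.diff] with x hx hy using hx.sub hy
  diff_gradient := (hF.diff_gradient.sub hG.diff_gradient).congr_of_eventuallyEq
    (hF.gradient_sub hG)

lemma TwiceDiffAt.const_mul (c : ℝ) (hF : TwiceDiffAt F θ) :
    TwiceDiffAt (fun x => c * F x) θ where
  diff := by
    filter_upwards [hF.diff] with x hx using hx.const_mul c
  diff_gradient := (hF.diff_gradient.const_smul c).congr_of_eventuallyEq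
    (hF.gradient_const_mul c)

lemma twiceDiffAt_const (c : ℝ) : TwiceDiffAt (fun _ : E => c) θ where
  diff := by simp
  diff_gradient := by
    rw [gradient_fun_const']
    exact differentiableAt_const _

lemma TwiceDiffAt.sum {κ : Type*} {s : Finset κ} {F : κ → E → ℝ}
    (hF : ∀ k ∈ s, TwiceDiffAt (F k) θ) : TwiceDiffAt (fun x => ∑ k ∈ s, F k x) θ := by
  classical
  induction s using Finset.induction_on with
  | empty => simpa using twiceDiffAt_const 0
  | insert a s ha ih =>
    simp only [Finset.sum_insert ha]
    exact (hF a (Finset.mem_insert_self _ _)).add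
      (ih fun k hk => hF k (Finset.mem_insert_of_mem hk))

/-- The derivative of the gradient of `log F` in terms of the value, the gradient and the derivative
of the gradient of `F`. -/
noncomputable def logHess (x : ℝ × E × (E →L[ℝ] E)) : E →L[ℝ] E :=
  x.1⁻¹ • x.2.2 - (x.1 ^ 2)⁻¹ • (innerSL ℝ x.2.1).smulRight x.2.1

omit [CompleteSpace E] in
lemma continuousAt_logHess {x : ℝ × E × (E →L[ℝ] E)} (hx : x.1 ≠ 0) : ContinuousAt logHess x := by
  have h1 : Continuous fun v : E => (innerSL ℝ v).smulRight v := by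
    have := (ContinuousLinearMap.smulRightL ℝ E E).continuous₂.comp
      (((innerSL ℝ).continuous).prodMk (continuous_id (X := E)))
    exact this
  unfold logHess
  refine ContinuousAt.sub ?_ ?_
  · exact (continuousAt_fst.inv₀ hx).smul (continuous_snd.comp continuous_snd).continuousAt
  · exact ((continuousAt_fst.pow 2).inv₀ (pow_ne_zero 2 hx)).smul
      (h1.comp (continuous_fst.comp continuous_snd)).continuousAt

lemma TwiceDiffAt.hasFDerivAt_gradient_log (hF : TwiceDiffAt F θ) (h0 : F θ ≠ 0) :
    HasFDerivAt (gradient fun x => Real.log (F x))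
      (logHess (F θ, gradient F θ, fderiv ℝ (gradient F) θ)) θ := by
  refine HasFDerivAt.congr_of_eventuallyEq ?_ (hF.gradient_log h0)
  have h1 := (hasDerivAt_inv h0).comp_hasFDerivAt θ hF.hasGradientAt.hasFDerivAt
  have h2 := h1.smul hF.diff_gradient.hasFDerivAt
  convert! h2 using 1
  ext1 u
  simp [logHess, smul_smul, sub_eq_add_neg]

lemma TwiceDiffAt.log (hF : TwiceDiffAt F θ) (h0 : F θ ≠ 0) :
    TwiceDiffAt (fun x => Real.log (F x)) θ where
  diff := by
    filter_upwards [hF.diff, hF.eventually_ne h0] with x hx hx0 using hx.log hx0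
  diff_gradient := (hF.hasFDerivAt_gradient_log h0).differentiableAt

lemma TwiceDiffAt.fderiv_gradient_add (hF : TwiceDiffAt F θ) (hG : TwiceDiffAt G θ) :
    fderiv ℝ (gradient fun x => F x + G x) θ =
      fderiv ℝ (gradient F) θ + fderiv ℝ (gradient G) θ :=
  ((hF.diff_gradient.hasFDerivAt.add hG.diff_gradient.hasFDerivAt).congr_of_eventuallyEq
    (hF.gradient_add hG)).fderiv

lemma TwiceDiffAt.fderiv_gradient_sub (hF : TwiceDiffAt F θ) (hG : TwiceDiffAt G θ) :
    fderiv ℝ (gradient fun x => F x - G x) θ =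
      fderiv ℝ (gradient F) θ - fderiv ℝ (gradient G) θ :=
  ((hF.diff_gradient.hasFDerivAt.sub hG.diff_gradient.hasFDerivAt).congr_of_eventuallyEq
    (hF.gradient_sub hG)).fderiv

lemma contDiff_gradient {n : WithTop ℕ∞} (hF : ContDiff ℝ (n + 1) F) :
    ContDiff ℝ n (gradient F) :=
  (InnerProductSpace.toDual ℝ E).symm.toContinuousLinearEquiv.contDiff.comp
    (hF.fderiv_right le_rfl)

lemma twiceDiffAt_of_contDiff (hF : ContDiff ℝ 2 F) : TwiceDiffAt F θ where
  diff := Eventually.of_forall fun x => (hF.differentiable (by norm_num)) x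
  diff_gradient := ((contDiff_gradient (n := 1) (by simpa [one_add_one_eq_two] using hF)).differentiable
    (by norm_num)) θ

lemma _root_.IsMaxOn.gradient_eq_zero (h : IsMaxOn F Set.univ θ) : gradient F θ = 0 := by
  have := (h.isLocalMax univ_mem).fderiv_eq_zero
  simp [gradient, this]

end Gradient

/-! ### Hessian matrices as operators -/

section Hess

variable {p : ℕ}

lemma toEuclideanCLM_apply_apply (A : Matrix (Fin p) (Fin p) ℝ) (v : Param p) (i : Fin p) :
    Matrix.toEuclideanCLM (𝕜 := ℝ) A v i = ∑ j, A i j * v j := by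
  rw [Matrix.ofLp_toEuclideanCLM]
  rfl

lemma toEuclideanCLM_hess (F : Param p → ℝ) (θ : Param p) :
    Matrix.toEuclideanCLM (𝕜 := ℝ) (hess F θ) = fderiv ℝ (gradient F) θ := by
  refine ContinuousLinearMap.coe_injective ((EuclideanSpace.basisFun (Fin p) ℝ).toBasis.ext
    fun j => ?_)
  ext i
  simp only [OrthonormalBasis.coe_toBasis, EuclideanSpace.basisFun_apply,
    ContinuousLinearMap.coe_coe]
  rw [toEuclideanCLM_apply_apply]
  simp [hess, PiLp.single_apply]

/-- Cauchy–Schwarz in each row. It turns the Frobenius-norm hypotheses into operator-norm limits. -/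
lemma norm_toEuclideanCLM_le (A : Matrix (Fin p) (Fin p) ℝ) :
    ‖Matrix.toEuclideanCLM (𝕜 := ℝ) A‖ ≤ matNorm A := by
  refine ContinuousLinearMap.opNorm_le_bound _ (Real.sqrt_nonneg _) fun v => ?_
  have h0 : 0 ≤ ∑ i, ∑ j, A i j ^ 2 :=
    Finset.sum_nonneg fun i _ => Finset.sum_nonneg fun j _ => sq_nonneg _
  rw [EuclideanSpace.norm_eq, EuclideanSpace.norm_eq, matNorm]
  refine le_of_le_of_eq (Real.sqrt_le_sqrt ?_) (Real.sqrt_mul h0 _)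
  rw [Finset.sum_mul]
  refine Finset.sum_le_sum fun i _ => ?_
  simp only [Real.norm_eq_abs, sq_abs]
  rw [toEuclideanCLM_apply_apply]
  exact Finset.sum_mul_sq_le_sq_mul_sq _ _ _

lemma norm_fderiv_gradient_sub_le (F G : Param p → ℝ) (θ : Param p) :
    ‖fderiv ℝ (gradient F) θ - fderiv ℝ (gradient G) θ‖ ≤ matNorm (hess F θ - hess G θ) := by
  rw [← toEuclideanCLM_hess, ← toEuclideanCLM_hess, ← map_sub]
  exact norm_toEuclideanCLM_le _

lemma norm_fderiv_gradient_sub_toEuclideanCLM_le (F : Param p → ℝ) (θ : Param p)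
    (B : Matrix (Fin p) (Fin p) ℝ) :
    ‖fderiv ℝ (gradient F) θ - Matrix.toEuclideanCLM (𝕜 := ℝ) B‖ ≤ matNorm (hess F θ - B) := by
  rw [← toEuclideanCLM_hess, ← map_sub]
  exact norm_toEuclideanCLM_le _

end Hess

/-! ### Normalized sums: moments, tightness, characteristic functions -/

section CLT

variable {Ω : Type*} [MeasurableSpace Ω] {P : Measure Ω} {p : ℕ}

/-- The normalized sum `n^{-1/2} (X_0 + ⋯ + X_{n-1})`. -/
noncomputable def normSum (X : ℕ → Ω → Param p) (n : ℕ) (ω : Ω) : Param p :=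
  (√(n : ℝ))⁻¹ • ∑ k ∈ Finset.range n, X k ω

lemma charFun_map_eq {A : Ω → Param p} (hA : AEMeasurable A P) (a : Param p) :
    charFun (P.map A) a = ∫ ω, Complex.exp ((inner ℝ (A ω) a : ℝ) * Complex.I) ∂P := by
  rw [charFun_apply, integral_map hA (by fun_prop)]

/-- Follows from |exp(ix) − 1| ≤ |x|. For normalized sums it yields a Lipschitz bound independent of
n. -/
lemma norm_charFun_map_sub_le [IsProbabilityMeasure P] {A : Ω → Param p} (hA : AEMeasurable A P)
    (a b : Param p) (hi : Integrable (fun ω => inner ℝ (A ω) (a - b)) P) :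
    ‖charFun (P.map A) a - charFun (P.map A) b‖ ≤ ∫ ω, |inner ℝ (A ω) (a - b)| ∂P := by
  have hint : ∀ c : Param p,
      Integrable (fun ω => Complex.exp ((inner ℝ (A ω) c : ℝ) * Complex.I)) P := fun c => by
    refine Integrable.of_bound (C := 1) ?_ (Eventually.of_forall fun ω => ?_)
    · exact AEMeasurable.aestronglyMeasurable (by fun_prop)
    · rw [Complex.norm_exp_ofReal_mul_I]
  rw [charFun_map_eq hA, charFun_map_eq hA, ← integral_sub (hint a) (hint b)]
  refine norm_integral_le_of_norm_le hi.abs (Eventually.of_forall fun ω => ?_)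
  have h : Complex.exp ((inner ℝ (A ω) a : ℝ) * Complex.I)
      - Complex.exp ((inner ℝ (A ω) b : ℝ) * Complex.I)
      = Complex.exp ((inner ℝ (A ω) b : ℝ) * Complex.I) *
        (Complex.exp (Complex.I * (inner ℝ (A ω) (a - b) : ℝ)) - 1) := by
    rw [mul_sub, mul_one, ← Complex.exp_add, inner_sub_right]
    congr 2
    push_cast
    ring
  rw [h, norm_mul, Complex.norm_exp_ofReal_mul_I, one_mul]
  exact Real.norm_exp_I_mul_ofReal_sub_one_le

variable {X : ℕ → Ω → Param p}

omit [MeasurableSpace Ω] in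
lemma inner_normSum (n : ℕ) (ω : Ω) (a : Param p) :
    inner ℝ (normSum X n ω) a = (√(n : ℝ))⁻¹ * ∑ k ∈ Finset.range n, inner ℝ (X k ω) a := by
  rw [normSum, real_inner_smul_left, sum_inner]

lemma aemeasurable_normSum (hX : ∀ k, AEMeasurable (X k) P) (n : ℕ) :
    AEMeasurable (normSum X n) P := by
  unfold normSum
  exact AEMeasurable.const_smul (Finset.aemeasurable_fun_sum _ fun k _ => hX k) (√(n : ℝ))⁻¹

lemma memLp_inner {A : Ω → Param p} (hA : MemLp A 2 P) (a : Param p) :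
    MemLp (fun ω => inner ℝ (A ω) a) 2 P := by
  simpa using hA.inner_const a

variable [IsProbabilityMeasure P]

omit [IsProbabilityMeasure P] in
lemma memLp_normSum (hX : ∀ k, MemLp (X k) 2 P) (n : ℕ) : MemLp (normSum X n) 2 P := by
  unfold normSum
  have h : MemLp (fun ω => ∑ k ∈ Finset.range n, X k ω) 2 P := memLp_finsetSum _ fun k _ => hX k
  exact h.const_smul (√(n : ℝ))⁻¹

/-- The variance of |Z| is nonnegative. -/
lemma integral_abs_le_sqrt {Z : Ω → ℝ} (hZ : MemLp Z 2 P) :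
    ∫ ω, |Z ω| ∂P ≤ √(∫ ω, Z ω ^ 2 ∂P) := by
  refine Real.le_sqrt_of_sq_le ?_
  have h := variance_nonneg (fun ω => |Z ω|) P
  rw [variance_eq_sub (by simpa using hZ.norm)] at h
  simp only [Pi.pow_apply, sq_abs] at h
  linarith

lemma integral_inner_normSum_sq_le (hX : MemLp (X 0) 2 P) (h0 : ∫ ω, X 0 ω ∂P = 0)
    (hindep : iIndepFun X P) (hident : ∀ k, IdentDistrib (X k) (X 0) P P) (n : ℕ) (a : Param p) :
    ∫ ω, (inner ℝ (normSum X n ω) a) ^ 2 ∂P ≤ Var[fun ω => inner ℝ (X 0 ω) a; P] := by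
  have hXk : ∀ k, MemLp (X k) 2 P := fun k => (hident k).memLp_iff.2 hX
  have hm : Measurable fun v : Param p => (inner ℝ v a : ℝ) := by fun_prop
  have hidk : ∀ k, IdentDistrib (fun ω => (inner ℝ (X k ω) a : ℝ)) (fun ω => inner ℝ (X 0 ω) a) P P :=
    fun k => (hident k).comp hm
  have hm0 : ∀ k, ∫ ω, (inner ℝ (X k ω) a : ℝ) ∂P = 0 := fun k => by
    rw [(hidk k).integral_eq]
    have := integral_inner (𝕜 := ℝ) (hX.integrable one_le_two) a
    simp only [real_inner_comm] at this ⊢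
    rw [this, h0, inner_zero_right]
  have hind : iIndepFun (fun k ω => (inner ℝ (X k ω) a : ℝ)) P := hindep.comp _ fun _ => hm
  have hvar : Var[∑ k ∈ Finset.range n, fun ω => (inner ℝ (X k ω) a : ℝ); P]
      = n * Var[fun ω => inner ℝ (X 0 ω) a; P] := by
    rw [IndepFun.variance_sum (fun k _ => memLp_inner (hXk k) a)
      (fun i _ j _ hij => hind.indepFun hij)]
    simp [fun k => (hidk k).variance_eq]
  have hmean : ∫ ω, (∑ k ∈ Finset.range n, fun ω => (inner ℝ (X k ω) a : ℝ)) ω ∂P = 0 := by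
    simp only [Finset.sum_apply]
    rw [integral_finsetSum _ fun k _ => (memLp_inner (hXk k) a).integrable one_le_two]
    simp [hm0]
  have hms : MemLp (∑ k ∈ Finset.range n, fun ω => (inner ℝ (X k ω) a : ℝ)) 2 P :=
    memLp_finsetSum' _ fun k _ => memLp_inner (hXk k) a
  rw [variance_of_integral_eq_zero hms.aemeasurable hmean] at hvar
  simp only [Finset.sum_apply] at hvar
  simp only [inner_normSum, mul_pow]
  rw [integral_const_mul, hvar, inv_pow, Real.sq_sqrt (Nat.cast_nonneg n), ← mul_assoc]
  -- Only n⁻¹ · n ≤ 1 is available, since the product is 0 for n = 0.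
  refine mul_le_of_le_one_left (variance_nonneg _ _) ?_
  exact inv_mul_le_one

lemma variance_inner_le (hX : MemLp (X 0) 2 P) (a : Param p) :
    Var[fun ω => inner ℝ (X 0 ω) a; P] ≤ (∫ ω, ‖X 0 ω‖ ^ 2 ∂P) * ‖a‖ ^ 2 := by
  refine (variance_le_expectation_sq (memLp_inner hX a).aestronglyMeasurable).trans ?_
  rw [← integral_mul_const]
  refine integral_mono (memLp_inner hX a).integrable_sq
    ((hX.norm.integrable_sq).mul_const _) fun ω => ?_
  simp only [Pi.pow_apply, ← mul_pow]
  exact sq_le_sq' (neg_le_of_abs_le (abs_real_inner_le_norm _ _)) (real_inner_le_norm _ _)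

lemma integral_abs_inner_normSum_le (hX : MemLp (X 0) 2 P) (h0 : ∫ ω, X 0 ω ∂P = 0)
    (hindep : iIndepFun X P) (hident : ∀ k, IdentDistrib (X k) (X 0) P P) (n : ℕ) (a : Param p) :
    ∫ ω, |inner ℝ (normSum X n ω) a| ∂P ≤ √(∫ ω, ‖X 0 ω‖ ^ 2 ∂P) * ‖a‖ := by
  have hXk : ∀ k, MemLp (X k) 2 P := fun k => (hident k).memLp_iff.2 hX
  refine (integral_abs_le_sqrt (memLp_inner (memLp_normSum hXk n) a)).trans ?_
  refine (Real.sqrt_le_sqrt ((integral_inner_normSum_sq_le hX h0 hindep hident n a).trans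
    (variance_inner_le hX a))).trans_eq ?_
  rw [Real.sqrt_mul (integral_nonneg fun _ => sq_nonneg _), Real.sqrt_sq (norm_nonneg _)]

lemma tightAlong_norm_normSum (hX : MemLp (X 0) 2 P) (h0 : ∫ ω, X 0 ω ∂P = 0)
    (hindep : iIndepFun X P) (hident : ∀ k, IdentDistrib (X k) (X 0) P P) :
    TightAlong P atTop fun n ω => ‖normSum X n ω‖ := by
  have hXk : ∀ k, MemLp (X k) 2 P := fun k => (hident k).memLp_iff.2 hX
  have hi : ∀ n, Integrable (normSum X n) P := fun n =>
    (memLp_normSum hXk n).integrable one_le_two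
  refine tightAlong_of_integral_le (K := ∑ i : Fin p,
    √(∫ ω, ‖X 0 ω‖ ^ 2 ∂P) * ‖EuclideanSpace.single i (1 : ℝ)‖) (fun _ _ => norm_nonneg _)
    (fun n => (hi n).norm) fun n => ?_
  calc ∫ ω, ‖normSum X n ω‖ ∂P
      ≤ ∫ ω, ∑ i : Fin p, |inner ℝ (normSum X n ω) (EuclideanSpace.single i (1 : ℝ))| ∂P := by
        refine integral_mono (hi n).norm (integrable_finsetSum _ fun i _ =>
          ((memLp_inner (memLp_normSum hXk n) _).integrable one_le_two).abs) fun ω => ?_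
        have h := (EuclideanSpace.basisFun (Fin p) ℝ).sum_repr (normSum X n ω)
        conv_lhs => rw [← h]
        refine (norm_sum_le _ _).trans (Finset.sum_le_sum fun i _ => ?_)
        simp [norm_smul, EuclideanSpace.inner_single_right]
    _ = ∑ i : Fin p, ∫ ω, |inner ℝ (normSum X n ω) (EuclideanSpace.single i (1 : ℝ))| ∂P :=
        integral_finsetSum _ fun i _ =>
          ((memLp_inner (memLp_normSum hXk n) _).integrable one_le_two).abs
    _ ≤ _ := Finset.sum_le_sum fun i _ => integral_abs_inner_normSum_le hX h0 hindep hident n _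

/-- Cramér–Wold: the scalar central limit theorem is applied to the inner products with a, and their
characteristic function at 1 is that of the vector sums at a. -/
lemma tendsto_charFun_normSum (hX : MemLp (X 0) 2 P) (h0 : ∫ ω, X 0 ω ∂P = 0)
    (hindep : iIndepFun X P) (hident : ∀ k, IdentDistrib (X k) (X 0) P P) (a : Param p) :
    Tendsto (fun n => charFun (P.map (normSum X n)) a) atTop
      (𝓝 (Complex.exp (-(Var[fun ω => inner ℝ (X 0 ω) a; P] : ℝ) / 2))) := by
  have hXk : ∀ k, MemLp (X k) 2 P := fun k => (hident k).memLp_iff.2 hX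
  have hm : Measurable fun v : Param p => (inner ℝ v a : ℝ) := by fun_prop
  have hm0 : ∫ ω, (inner ℝ (X 0 ω) a : ℝ) ∂P = 0 := by
    have := integral_inner (𝕜 := ℝ) (hX.integrable one_le_two) a
    simp only [real_inner_comm] at this ⊢
    rw [this, h0, inner_zero_right]
  have hclt := tendstoInDistribution_inv_sqrt_mul_sum_sub (P := P)
    (X := fun k ω => (inner ℝ (X k ω) a : ℝ)) (Y := id)
    (P' := gaussianReal 0 Var[fun ω => (inner ℝ (X 0 ω) a : ℝ); P].toNNReal) HasLaw.id
    (memLp_inner hX a) (hindep.comp _ fun _ => hm) (fun k => (hident k).comp hm)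
  have h1 := ProbabilityMeasure.tendsto_iff_tendsto_charFun.1 hclt.tendsto 1
  simp only [ProbabilityMeasure.coe_mk, Measure.map_id, charFun_gaussianReal, hm0, mul_zero,
    sub_zero] at h1
  have h2 : (Complex.exp (-(Var[fun ω => inner ℝ (X 0 ω) a; P] : ℝ) / 2)) =
      Complex.exp (((1 : ℝ) : ℂ) * ((0 : ℝ) : ℂ) * Complex.I -
        ((Var[fun ω => (inner ℝ (X 0 ω) a : ℝ); P].toNNReal : ℝ) : ℂ) * ((1 : ℝ) : ℂ) ^ 2 / 2) := by
    rw [Real.coe_toNNReal _ (variance_nonneg _ _)]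
    congr 1
    push_cast
    ring
  rw [h2]
  refine h1.congr fun n => ?_
  rw [charFun_map_eq (aemeasurable_normSum (fun k => (hXk k).aemeasurable) n), charFun_apply,
    integral_map]
  · refine integral_congr_ae (Eventually.of_forall fun ω => ?_)
    simp [inner_normSum]
  · exact (Finset.aemeasurable_fun_sum _ fun k _ =>
      hm.comp_aemeasurable (hXk k).aemeasurable).const_mul _
  · fun_prop

/-- The characteristic functions of normalized sums are asymptotically Gaussian, uniformly on
bounded sets. -/
lemma tendsto_charFun_normSum_sub (hX : MemLp (X 0) 2 P) (h0 : ∫ ω, X 0 ω ∂P = 0)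
    (hindep : iIndepFun X P) (hident : ∀ k, IdentDistrib (X k) (X 0) P P)
    {ι : Type*} {l : Filter ι} {n : ι → ℕ} (hn : Tendsto n l atTop) {b : ι → Param p} {R : ℝ}
    (hb : ∀ᶠ i in l, ‖b i‖ ≤ R) {q : Param p → ℝ} (hq : Continuous q)
    (hqv : ∀ a, q a = Var[fun ω => inner ℝ (X 0 ω) a; P]) :
    Tendsto (fun i => charFun (P.map (normSum X (n i))) (b i) - Complex.exp (-(q (b i) : ℝ) / 2))
      l (𝓝 0) := by
  have hXk : ∀ k, MemLp (X k) 2 P := fun k => (hident k).memLp_iff.2 hX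
  -- Along an ultrafilter the eventually bounded arguments `b i` converge to some c by compactness.
  -- The Lipschitz bound replaces `b i` by c, where pointwise convergence suffices.
  rw [tendsto_iff_ultrafilter]
  intro g hg
  have hmem : Metric.closedBall (0 : Param p) R ∈ Filter.map b g := by
    refine (hb.filter_mono hg).mono fun i hi => ?_
    simpa using hi
  obtain ⟨c, -, hc⟩ := (isCompact_closedBall (0 : Param p) R).ultrafilter_le_nhds
    (Ultrafilter.map b g) (le_principal_iff.2 hmem)
  have hbc : Tendsto b g (𝓝 c) := hc
  have h1 : Tendsto (fun i => charFun (P.map (normSum X (n i))) c) g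
      (𝓝 (Complex.exp (-(q c : ℝ) / 2))) := by
    rw [hqv]
    exact (tendsto_charFun_normSum hX h0 hindep hident c).comp (hn.mono_left hg)
  have h2 : Tendsto (fun i => charFun (P.map (normSum X (n i))) (b i)
      - charFun (P.map (normSum X (n i))) c) g (𝓝 0) := by
    refine squeeze_zero_norm (a := fun i => √(∫ ω, ‖X 0 ω‖ ^ 2 ∂P) * ‖b i - c‖) (fun i => ?_) ?_
    · refine (norm_charFun_map_sub_le (aemeasurable_normSum (fun k => (hXk k).aemeasurable) _) _ _
        ((memLp_inner (memLp_normSum hXk _) _).integrable one_le_two)).trans ?_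
      exact integral_abs_inner_normSum_le hX h0 hindep hident _ _
    · have : Tendsto (fun i => b i - c) g (𝓝 0) := by simpa using hbc.sub_const c
      simpa using this.norm.const_mul _
  have h3 : Tendsto (fun i => Complex.exp (-(q (b i) : ℝ) / 2)) g
      (𝓝 (Complex.exp (-(q c : ℝ) / 2))) := by
    have : Continuous fun a => Complex.exp (-(q a : ℝ) / 2) := by fun_prop
    exact (this.tendsto c).comp hbc
  have h4 := (h2.add h1).sub h3
  simpa using h4

end CLT

/-! ### Quadratic forms, inverse square roots and covariance matrices -/

section InvSqrt

variable {p : ℕ}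

/-- The quadratic form of a matrix. -/
noncomputable def quadForm (A : Matrix (Fin p) (Fin p) ℝ) (v : Param p) : ℝ :=
  inner ℝ v (Matrix.toEuclideanCLM (𝕜 := ℝ) A v)

lemma quadForm_eq_dotProduct (A : Matrix (Fin p) (Fin p) ℝ) (v : Param p) :
    quadForm A v = v.ofLp ⬝ᵥ A.mulVec v.ofLp :=
  Matrix.inner_toEuclideanCLM A v v

lemma continuous_quadForm (A : Matrix (Fin p) (Fin p) ℝ) : Continuous (quadForm A) := by
  unfold quadForm
  fun_prop

lemma quadForm_smul_right (A : Matrix (Fin p) (Fin p) ℝ) (c : ℝ) (v : Param p) :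
    quadForm A (c • v) = c ^ 2 * quadForm A v := by
  simp [quadForm, real_inner_smul_left, real_inner_smul_right]
  ring

lemma quadForm_add (A B : Matrix (Fin p) (Fin p) ℝ) (v : Param p) :
    quadForm (A + B) v = quadForm A v + quadForm B v := by
  simp [quadForm, inner_add_right]

lemma quadForm_smul (A : Matrix (Fin p) (Fin p) ℝ) (c : ℝ) (v : Param p) :
    quadForm (c • A) v = c * quadForm A v := by
  simp [quadForm, real_inner_smul_right]

lemma _root_.Matrix.PosDef.quadForm_pos {A : Matrix (Fin p) (Fin p) ℝ} (hA : A.PosDef)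
    {v : Param p} (hv : v ≠ 0) : 0 < quadForm A v := by
  have h := hA.dotProduct_mulVec_pos (x := v.ofLp) (by simpa using hv)
  rw [quadForm_eq_dotProduct]
  simpa using h

lemma _root_.Matrix.PosDef.exists_le_quadForm {A : Matrix (Fin p) (Fin p) ℝ} (hA : A.PosDef) :
    ∃ c : ℝ, 0 < c ∧ ∀ v : Param p, c * ‖v‖ ^ 2 ≤ quadForm A v := by
  -- The constant is the minimum of the form on the unit sphere; the sphere is empty only when the
  -- space is trivial.
  by_cases hp : (Metric.sphere (0 : Param p) 1).Nonempty
  · obtain ⟨u, hu, hmin⟩ := (isCompact_sphere (0 : Param p) 1).exists_isMinOn hp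
      (continuous_quadForm A).continuousOn
    have hu0 : u ≠ 0 := by
      rintro rfl
      simp at hu
    refine ⟨quadForm A u, hA.quadForm_pos hu0, fun v => ?_⟩
    by_cases hv : v = 0
    · simp [hv, quadForm]
    have hv' : ‖v‖ ≠ 0 := norm_ne_zero_iff.2 hv
    have h1 : quadForm A u ≤ quadForm A (‖v‖⁻¹ • v) := hmin (by simp [norm_smul, hv'])
    rw [quadForm_smul_right] at h1
    calc quadForm A u * ‖v‖ ^ 2 ≤ (‖v‖⁻¹ ^ 2 * quadForm A v) * ‖v‖ ^ 2 := by gcongr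
      _ = quadForm A v := by field_simp
  · refine ⟨1, one_pos, fun v => ?_⟩
    have hv : v = 0 := by
      by_contra hv
      exact hp ⟨‖v‖⁻¹ • v, by simp [norm_smul, norm_ne_zero_iff.2 hv]⟩
    simp [hv, quadForm]

lemma isHermitian_invSqrt (A : Matrix (Fin p) (Fin p) ℝ) : (invSqrt A).IsHermitian :=
  (Matrix.nonneg_iff_posSemidef.1 (CFC.sqrt_nonneg A)).isHermitian.inv

lemma inner_invSqrt_left (A : Matrix (Fin p) (Fin p) ℝ) (u v : Param p) :
    inner ℝ (Matrix.toEuclideanCLM (𝕜 := ℝ) (invSqrt A) u) v =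
      inner ℝ u (Matrix.toEuclideanCLM (𝕜 := ℝ) (invSqrt A) v) := by
  have h : star (Matrix.toEuclideanCLM (𝕜 := ℝ) (invSqrt A))
      = Matrix.toEuclideanCLM (𝕜 := ℝ) (invSqrt A) := by
    rw [← map_star, Matrix.star_eq_conjTranspose, isHermitian_invSqrt]
  conv_lhs => rw [← h, ContinuousLinearMap.star_eq_adjoint]
  exact ContinuousLinearMap.adjoint_inner_left _ _ _

/-- Amounts to A^{-1/2} A A^{-1/2} = 1. This identity makes the limiting Gaussian standard. -/
lemma quadForm_invSqrt {A : Matrix (Fin p) (Fin p) ℝ} (hA : A.PosDef) (v : Param p) :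
    quadForm A (Matrix.toEuclideanCLM (𝕜 := ℝ) (invSqrt A) v) = ‖v‖ ^ 2 := by
  have hS : CFC.sqrt A * CFC.sqrt A = A := CFC.sqrt_mul_sqrt_self A hA.posSemidef.nonneg
  have hdet : IsUnit (CFC.sqrt A).det := by
    have h1 : IsUnit A.det := (Matrix.isUnit_iff_isUnit_det A).1 hA.isUnit
    rw [← hS, Matrix.det_mul] at h1
    exact isUnit_of_mul_isUnit_left h1
  have h : invSqrt A * A * invSqrt A = 1 := by
    rw [invSqrt]
    conv_lhs => enter [1, 2]; rw [← hS]
    rw [← Matrix.mul_assoc, Matrix.nonsing_inv_mul _ hdet, Matrix.one_mul,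
      Matrix.mul_nonsing_inv _ hdet]
  rw [quadForm, inner_invSqrt_left, ← mul_apply_eq_comp, ← map_mul,
    ← mul_apply_eq_comp, ← map_mul, h, map_one, one_apply_eq_self,
    real_inner_self_eq_norm_sq]

lemma quadForm_covMat {S : Type*} [MeasurableSpace S] {μ : Measure S} [IsProbabilityMeasure μ]
    {X : S → Param p} (hX : MemLp X 2 μ) (a : Param p) :
    quadForm (covMat X μ) a = Var[fun y => inner ℝ (X y) a; μ] := by
  have hXi : ∀ i, MemLp (fun y => X y i) 2 μ := fun i => by
    simpa [EuclideanSpace.inner_single_right] using memLp_inner hX (EuclideanSpace.single i 1)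
  have h1 : (fun y => (inner ℝ (X y) a : ℝ)) = fun y => ∑ i, a i * X y i := by
    ext y
    simp [PiLp.inner_apply]
  rw [h1, ← covariance_self, covariance_fun_sum_fun_sum]
  · rw [quadForm_eq_dotProduct]
    simp only [dotProduct, Matrix.mulVec, covMat, Matrix.of_apply, Finset.mul_sum]
    refine Finset.sum_congr rfl fun i _ => Finset.sum_congr rfl fun j _ => ?_
    rw [covariance_const_mul_left, covariance_const_mul_right]
    ring
  · exact fun i => (hXi i).const_mul _
  · exact fun i => (hXi i).const_mul _
  · exact (memLp_finsetSum _ fun i _ => (hXi i).const_mul _).aemeasurable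

end InvSqrt

/-! ### Functions of an i.i.d. sample -/

section IID

variable {Ω S : Type*} [MeasurableSpace Ω] [MeasurableSpace S] {P : Measure Ω} {μ : Measure S}

/-- `Y 0, Y 1, …` are independent with common distribution `μ`. -/
structure IsIIDSample (P : Measure Ω) (Y : ℕ → Ω → S) (μ : Measure S) : Prop where
  measurable : ∀ i, Measurable (Y i)
  map_eq : ∀ i, P.map (Y i) = μ
  indep : iIndepFun Y P

variable {Y : ℕ → Ω → S} {p : ℕ}

lemma IsIIDSample.ae (hY : IsIIDSample P Y μ) {q : S → Prop} (hq : ∀ᵐ y ∂μ, q y) :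
    ∀ᵐ ω ∂P, ∀ i, q (Y i ω) := by
  rw [ae_all_iff]
  intro i
  rw [← hY.map_eq i] at hq
  exact ae_of_ae_map (hY.measurable i).aemeasurable hq

lemma IsIIDSample.identDistrib (hY : IsIIDSample P Y μ) {E : Type*} [MeasurableSpace E]
    {φ : S → E} (hφ : AEMeasurable φ μ) (i : ℕ) :
    IdentDistrib (fun ω => φ (Y i ω)) (fun ω => φ (Y 0 ω)) P P := by
  have h : IdentDistrib (Y i) (Y 0) P P :=
    ⟨(hY.measurable i).aemeasurable, (hY.measurable 0).aemeasurable,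
      (hY.map_eq i).trans (hY.map_eq 0).symm⟩
  exact h.comp_of_aemeasurable (by rwa [hY.map_eq i])

lemma IsIIDSample.iIndepFun_comp (hY : IsIIDSample P Y μ) {E : Type*} [MeasurableSpace E]
    {φ : S → E} (hφ : AEMeasurable φ μ) : iIndepFun (fun i ω => φ (Y i ω)) P :=
  hY.indep.comp₀ (fun _ => φ) (fun i => (hY.measurable i).aemeasurable)
    fun i => by rwa [hY.map_eq i]

lemma IsIIDSample.aemeasurable_comp (hY : IsIIDSample P Y μ) {E : Type*} [MeasurableSpace E]
    {φ : S → E} (hφ : AEMeasurable φ μ) (i : ℕ) : AEMeasurable (fun ω => φ (Y i ω)) P := by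
  rw [← hY.map_eq i] at hφ
  exact hφ.comp_measurable (hY.measurable i)

lemma IsIIDSample.memLp_comp (hY : IsIIDSample P Y μ) {φ : S → Param p} (hφ : MemLp φ 2 μ)
    (i : ℕ) : MemLp (fun ω => φ (Y i ω)) 2 P := by
  rw [← hY.map_eq i] at hφ
  exact hφ.comp_of_map (hY.measurable i).aemeasurable

lemma IsIIDSample.integral_comp (hY : IsIIDSample P Y μ) {E : Type*} [NormedAddCommGroup E]
    [NormedSpace ℝ E] {φ : S → E} (hφ : AEStronglyMeasurable φ μ) (i : ℕ) :
    ∫ ω, φ (Y i ω) ∂P = ∫ y, φ y ∂μ := by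
  conv_rhs => rw [← hY.map_eq i]
  rw [integral_map (hY.measurable i).aemeasurable (by rwa [hY.map_eq i])]

/-- The strong law, weakened to convergence in probability. -/
lemma IsIIDSample.tendsto_average [IsProbabilityMeasure P] (hY : IsIIDSample P Y μ) {E : Type*}
    [NormedAddCommGroup E] [NormedSpace ℝ E] [CompleteSpace E] [MeasurableSpace E] [BorelSpace E]
    {φ : S → E} (hφ : Integrable φ μ) :
    Tendsto (fun x : ℕ × Ω => (x.1 : ℝ)⁻¹ • ∑ i ∈ Finset.range x.1, φ (Y i x.2))
      (probFilter P atTop) (𝓝 (∫ y, φ y ∂μ)) := by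
  have hint : ∀ i, Integrable (fun ω => φ (Y i ω)) P := fun i => by
    have := hφ
    rw [← hY.map_eq i] at this
    exact this.comp_measurable (hY.measurable i)
  have hslln := strong_law_ae (fun i ω => φ (Y i ω)) (hint 0)
    (fun i j hij => (hY.iIndepFun_comp hφ.aemeasurable).indepFun hij)
    (hY.identDistrib hφ.aemeasurable)
  rw [hY.integral_comp hφ.aestronglyMeasurable 0] at hslln
  have hmeas : ∀ n : ℕ, AEStronglyMeasurable
      (fun ω => (n : ℝ)⁻¹ • ∑ i ∈ Finset.range n, φ (Y i ω)) P := fun n => by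
    have h : AEStronglyMeasurable (fun ω => ∑ i ∈ Finset.range n, φ (Y i ω)) P :=
      Finset.aestronglyMeasurable_fun_sum _ fun i _ => (hint i).aestronglyMeasurable
    exact h.const_smul _
  have h := tendstoInMeasure_of_tendsto_ae (g := fun _ => ∫ y, φ y ∂μ) hmeas hslln
  exact (tendsto_probFilter_iff (l := atTop)
    (X := fun (n : ℕ) ω => (n : ℝ)⁻¹ • ∑ i ∈ Finset.range n, φ (Y i ω))).2 h

lemma IsIIDSample.tightAlong_norm_normSum [IsProbabilityMeasure P] (hY : IsIIDSample P Y μ)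
    {φ : S → Param p} (hφ : MemLp φ 2 μ) (h0 : ∫ y, φ y ∂μ = 0) :
    TightAlong P atTop fun n ω => ‖normSum (fun i ω => φ (Y i ω)) n ω‖ :=
  MCML.tightAlong_norm_normSum (hY.memLp_comp hφ 0)
    ((hY.integral_comp hφ.aestronglyMeasurable 0).trans h0)
    (hY.iIndepFun_comp hφ.aestronglyMeasurable.aemeasurable)
    (hY.identDistrib hφ.aestronglyMeasurable.aemeasurable)

lemma IsIIDSample.tendsto_charFun_normSum_sub [IsProbabilityMeasure P] [IsProbabilityMeasure μ]
    (hY : IsIIDSample P Y μ)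
    {φ : S → Param p} (hφ : MemLp φ 2 μ) (h0 : ∫ y, φ y ∂μ = 0)
    {ι : Type*} {l : Filter ι} {n : ι → ℕ} (hn : Tendsto n l atTop) {b : ι → Param p} {R : ℝ}
    (hb : ∀ᶠ i in l, ‖b i‖ ≤ R) :
    Tendsto (fun i => charFun (P.map (normSum (fun i ω => φ (Y i ω)) (n i))) (b i) -
      Complex.exp (-(quadForm (covMat φ μ) (b i) : ℝ) / 2)) l (𝓝 0) := by
  refine MCML.tendsto_charFun_normSum_sub (hY.memLp_comp hφ 0)
    ((hY.integral_comp hφ.aestronglyMeasurable 0).trans h0)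
    (hY.iIndepFun_comp hφ.aestronglyMeasurable.aemeasurable)
    (hY.identDistrib hφ.aestronglyMeasurable.aemeasurable) hn hb (continuous_quadForm _) fun a => ?_
  rw [quadForm_covMat hφ, ← hY.map_eq 0]
  have h1 : AEMeasurable (fun y => (inner ℝ (φ y) a : ℝ)) (P.map (Y 0)) := by
    rw [hY.map_eq 0]
    exact (memLp_inner hφ a).aemeasurable
  rw [variance_map h1 (hY.measurable 0).aemeasurable]
  rfl

end IID

/-! ### Integration against a density -/

section Density

variable {S : Type*} [MeasurableSpace S] {ν : Measure S} {q : S → ℝ}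

lemma IsDensity.isProbabilityMeasure_law (hq : IsDensity ν q) :
    IsProbabilityMeasure (law ν q) :=
  ⟨by rw [law, withDensity_apply _ MeasurableSet.univ, Measure.restrict_univ, hq.lintegral_eq_one]⟩

lemma IsDensity.ae_law_iff (hq : IsDensity ν q) {r : S → Prop} :
    (∀ᵐ y ∂(law ν q), r y) ↔ ∀ᵐ y ∂ν, 0 < q y → r y := by
  rw [law, ae_withDensity_iff hq.measurable.ennreal_ofReal]
  simp

lemma IsDensity.integrable_law_iff (hq : IsDensity ν q) {E : Type*} [NormedAddCommGroup E]
    [NormedSpace ℝ E] {φ : S → E} :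
    Integrable φ (law ν q) ↔ Integrable (fun y => q y • φ y) ν := by
  rw [law, integrable_withDensity_iff_integrable_smul' hq.measurable.ennreal_ofReal
    (Eventually.of_forall fun _ => ENNReal.ofReal_lt_top)]
  simp only [ENNReal.toReal_ofReal (hq.nonneg _)]

lemma IsDensity.integral_law (hq : IsDensity ν q) {E : Type*} [NormedAddCommGroup E]
    [NormedSpace ℝ E] (φ : S → E) : ∫ y, φ y ∂(law ν q) = ∫ y, q y • φ y ∂ν := by
  rw [law, integral_withDensity_eq_integral_toReal_smul hq.measurable.ennreal_ofReal
    (Eventually.of_forall fun _ => ENNReal.ofReal_lt_top)]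
  simp only [ENNReal.toReal_ofReal (hq.nonneg _)]

end Density

/-! ### The model, its likelihoods and importance sampling -/

section Model

variable {S : Type*} [MeasurableSpace S] {ν : Measure S} {p : ℕ} {f : S → Param p → ℝ}
  {g h : S → ℝ}

/-- A zero integral would force f(·|θ) to vanish ν-a.e., hence g-a.e., where it is positive. -/
lemma normConst_pos (hf_nonneg : ∀ y θ, 0 ≤ f y θ) (hg : IsDensity ν g)
    (hf_pos : ∀ᵐ y ∂(law ν g), ∀ θ, 0 < f y θ) (hf_diff : DiffUnderIntegral ν f) (θ : Param p) :
    0 < normConst ν f θ := by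
  refine lt_of_le_of_ne (integral_nonneg fun y => hf_nonneg y θ) fun h0 => ?_
  have h1 := (integral_eq_zero_iff_of_nonneg (fun y => hf_nonneg y θ) (hf_diff.integrable θ)).1
    h0.symm
  have h2 : ∀ᵐ y ∂(law ν g), f y θ = 0 := by
    rw [hg.ae_law_iff]
    filter_upwards [h1] with y hy _ using hy
  have := hg.isProbabilityMeasure_law
  obtain ⟨y, hy1, hy2⟩ := (hf_pos.and h2).exists
  exact (hy1 θ).ne' hy2

lemma DiffUnderIntegral.twiceDiffAt (hf_diff : DiffUnderIntegral ν f) (θ : Param p) :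
    TwiceDiffAt (normConst ν f) θ where
  diff := Eventually.of_forall fun x => (hf_diff.hasGradientAt x).differentiableAt
  diff_gradient := (hf_diff.hasFDerivAt_gradient θ).differentiableAt

lemma twiceDiffAt_logDensity (hf_smooth : ∀ y, ContDiff ℝ 2 (f y))
    (hf_diff : DiffUnderIntegral ν f) (hC : ∀ θ, 0 < normConst ν f θ) {y : S}
    (hy : ∀ θ, 0 < f y θ) (θ : Param p) : TwiceDiffAt (logDensity ν f y) θ :=
  ((twiceDiffAt_of_contDiff (hf_smooth y)).log (hy θ).ne').sub
    ((hf_diff.twiceDiffAt θ).log (hC θ).ne')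

lemma gradient_logDensity (hf_smooth : ∀ y, ContDiff ℝ 2 (f y))
    (hf_diff : DiffUnderIntegral ν f) (hC : ∀ θ, 0 < normConst ν f θ) {y : S}
    (hy : ∀ θ, 0 < f y θ) (θ : Param p) :
    gradient (logDensity ν f y) θ = (f y θ)⁻¹ • gradient (f y) θ -
      (normConst ν f θ)⁻¹ • gradient (normConst ν f) θ :=
  (((twiceDiffAt_of_contDiff (hf_smooth y)).hasGradientAt.log (hy θ).ne').sub
    ((hf_diff.twiceDiffAt θ).hasGradientAt.log (hC θ).ne')).gradient

lemma logLik_eq (n : ℕ) (y : ℕ → S) :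
    logLik ν f n y = fun θ => (1 / (n : ℝ)) * ∑ i ∈ Finset.range n, logDensity ν f (y i) θ := rfl

lemma twiceDiffAt_logLik (hf_smooth : ∀ y, ContDiff ℝ 2 (f y))
    (hf_diff : DiffUnderIntegral ν f) (hC : ∀ θ, 0 < normConst ν f θ) {y : ℕ → S}
    (hy : ∀ i θ, 0 < f (y i) θ) (n : ℕ) (θ : Param p) : TwiceDiffAt (logLik ν f n y) θ := by
  rw [logLik_eq]
  exact (TwiceDiffAt.sum fun i _ =>
    twiceDiffAt_logDensity hf_smooth hf_diff hC (hy i) θ).const_mul _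

lemma gradient_logLik (hf_smooth : ∀ y, ContDiff ℝ 2 (f y))
    (hf_diff : DiffUnderIntegral ν f) (hC : ∀ θ, 0 < normConst ν f θ) {y : ℕ → S}
    (hy : ∀ i θ, 0 < f (y i) θ) (n : ℕ) (θ : Param p) :
    gradient (logLik ν f n y) θ =
      (n : ℝ)⁻¹ • ∑ i ∈ Finset.range n, gradient (logDensity ν f (y i)) θ := by
  rw [logLik_eq, ← one_div]
  exact ((HasGradientAt.sum fun i _ =>
    (twiceDiffAt_logDensity hf_smooth hf_diff hC (hy i) θ).hasGradientAt).const_mul _).gradient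

omit [MeasurableSpace S] in
lemma contDiff_mcConst (hf_smooth : ∀ y, ContDiff ℝ 2 (f y)) (m : ℕ) (z : ℕ → S) :
    ContDiff ℝ 2 (mcConst f h m z) := by
  unfold mcConst
  exact contDiff_const.mul (ContDiff.sum fun k _ => (hf_smooth (z k)).div_const _)

omit [MeasurableSpace S] in
lemma mcConst_eq (m : ℕ) (z : ℕ → S) (θ : Param p) :
    mcConst f h m z θ = (m : ℝ)⁻¹ • ∑ k ∈ Finset.range m, f (z k) θ / h (z k) := by
  rw [mcConst, one_div, smul_eq_mul]

omit [MeasurableSpace S] in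
lemma gradient_mcConst (hf_smooth : ∀ y, ContDiff ℝ 2 (f y)) (m : ℕ) (z : ℕ → S)
    (θ : Param p) : gradient (mcConst f h m z) θ =
      (m : ℝ)⁻¹ • ∑ k ∈ Finset.range m, (h (z k))⁻¹ • gradient (f (z k)) θ := by
  have h1 : mcConst f h m z =
      fun θ => (m : ℝ)⁻¹ * ∑ k ∈ Finset.range m, (h (z k))⁻¹ * f (z k) θ := by
    ext θ
    simp only [mcConst, one_div]
    simp only [div_eq_inv_mul]
  rw [h1]
  exact ((HasGradientAt.sum fun k _ =>
    (twiceDiffAt_of_contDiff (hf_smooth (z k))).hasGradientAt.const_mul _).const_mul _).gradient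

/-- The average of `mcScore` at the Monte Carlo points. -/
lemma average_mcScore (hf_smooth : ∀ y, ContDiff ℝ 2 (f y)) (m : ℕ) (z : ℕ → S) (θ : Param p) :
    (m : ℝ)⁻¹ • ∑ k ∈ Finset.range m, mcScore ν f h θ (z k) = gradient (mcConst f h m z) θ -
      mcConst f h m z θ • ((normConst ν f θ)⁻¹ • gradient (normConst ν f) θ) := by
  simp only [mcScore, Finset.sum_sub_distrib, smul_sub, gradient_mcConst hf_smooth, mcConst_eq,
    ← Finset.sum_smul]
  simp only [smul_eq_mul, smul_smul, mul_assoc]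

/-- Isolates the Monte Carlo error as log C − log C_m. For n = 0 the empty sum would drop the term
log C. -/
lemma mcLogLik_eq {n : ℕ} (hn : n ≠ 0) (m : ℕ) (y z : ℕ → S) :
    mcLogLik f h n m y z = fun θ => logLik ν f n y θ +
      (Real.log (normConst ν f θ) - Real.log (mcConst f h m z θ)) := by
  ext θ
  have hn' : (n : ℝ) ≠ 0 := Nat.cast_ne_zero.2 hn
  simp only [mcLogLik, logLik, Finset.sum_sub_distrib, Finset.sum_const, Finset.card_range,
    nsmul_eq_mul]
  field_simp
  ring

/-- The unnormalized densities and their gradients vanish where the instrumental density does. -/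
lemma ae_eq_zero_of_instrumental_eq_zero (hf_smooth : ∀ y, ContDiff ℝ 2 (f y))
    (hh_supp : ∀ θ, ∀ᵐ y ∂ν, h y = 0 → f y θ = 0) :
    ∀ᵐ y ∂ν, h y = 0 → f y = 0 := by
  -- The null set in the support condition depends on θ; a countable dense set of parameters and
  -- continuity in θ give a single one.
  have h1 : ∀ᵐ y ∂ν, ∀ k, h y = 0 → f y (TopologicalSpace.denseSeq (Param p) k) = 0 :=
    ae_all_iff.2 fun k => hh_supp _
  filter_upwards [h1] with y hy hy0
  exact (hf_smooth y).continuous.ext_on (TopologicalSpace.denseRange_denseSeq (Param p))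
    continuous_zero (by rintro _ ⟨k, rfl⟩; exact hy k hy0)

lemma ae_smul_inv_smul {E : Type*} [AddCommGroup E] [Module ℝ E] {ψ : S → E}
    (hψ : ∀ᵐ y ∂ν, h y = 0 → ψ y = 0) : (fun y => h y • (h y)⁻¹ • ψ y) =ᵐ[ν] ψ := by
  filter_upwards [hψ] with y hy
  by_cases h0 : h y = 0
  · simp [h0, hy h0]
  · rw [smul_smul, mul_inv_cancel₀ h0, one_smul]

lemma integrable_importance (hh : IsDensity ν h) {E : Type*} [NormedAddCommGroup E]
    [NormedSpace ℝ E] {ψ : S → E} (hψ0 : ∀ᵐ y ∂ν, h y = 0 → ψ y = 0) (hψ : Integrable ψ ν) :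
    Integrable (fun y => (h y)⁻¹ • ψ y) (law ν h) := by
  rw [hh.integrable_law_iff]
  exact hψ.congr (ae_smul_inv_smul hψ0).symm

lemma integral_importance (hh : IsDensity ν h) {E : Type*} [NormedAddCommGroup E]
    [NormedSpace ℝ E] {ψ : S → E} (hψ0 : ∀ᵐ y ∂ν, h y = 0 → ψ y = 0) :
    ∫ y, (h y)⁻¹ • ψ y ∂(law ν h) = ∫ y, ψ y ∂ν := by
  rw [hh.integral_law]
  exact integral_congr_ae (ae_smul_inv_smul hψ0)

lemma ae_gradient_eq_zero (hf0 : ∀ᵐ y ∂ν, h y = 0 → f y = 0) (θ : Param p) :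
    ∀ᵐ y ∂ν, h y = 0 → gradient (f y) θ = 0 := by
  filter_upwards [hf0] with y hy hy0
  rw [hy hy0]
  exact gradient_const θ (0 : ℝ)

lemma integrable_mcRatio (hh : IsDensity ν h) (hf0 : ∀ᵐ y ∂ν, h y = 0 → f y = 0)
    (hf_diff : DiffUnderIntegral ν f) (θ : Param p) :
    Integrable (fun y => f y θ / h y) (law ν h) := by
  simpa only [smul_eq_mul, div_eq_inv_mul] using integrable_importance hh
    (ψ := fun y => f y θ) (hf0.mono fun y hy hy0 => by simp [hy hy0]) (hf_diff.integrable θ)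

lemma integral_mcRatio (hh : IsDensity ν h) (hf0 : ∀ᵐ y ∂ν, h y = 0 → f y = 0) (θ : Param p) :
    ∫ y, f y θ / h y ∂(law ν h) = normConst ν f θ := by
  rw [normConst]
  simpa only [smul_eq_mul, div_eq_inv_mul] using integral_importance hh
    (ψ := fun y => f y θ) (hf0.mono fun y hy hy0 => by simp [hy hy0])

/-- Importance sampling is unbiased: ∇f/h has mean ∇C and f/h has mean C, so the two terms cancel.
-/
lemma integral_mcScore (hh : IsDensity ν h) (hf0 : ∀ᵐ y ∂ν, h y = 0 → f y = 0)
    (hf_diff : DiffUnderIntegral ν f) {θ : Param p} (hC : 0 < normConst ν f θ) :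
    ∫ y, mcScore ν f h θ y ∂(law ν h) = 0 := by
  unfold mcScore
  rw [integral_sub (integrable_importance hh (ae_gradient_eq_zero hf0 θ)
      (hf_diff.integrable_gradient θ)) ((integrable_mcRatio hh hf0 hf_diff θ).smul_const _),
    integral_importance hh (ae_gradient_eq_zero hf0 θ), integral_smul_const,
    integral_mcRatio hh hf0, ← (hf_diff.hasGradientAt θ).gradient, smul_smul,
    mul_inv_cancel₀ hC.ne', one_smul, sub_self]

end Model

/-! ### Uniform convergence of Hessians near the target parameter -/

section UniformLimits

lemma continuousAt_of_tendsto_sub_prod {X E F : Type*} [TopologicalSpace E] [NormedAddCommGroup F]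
    {𝓕 : Filter X} [𝓕.NeBot] {H : X → E → F} {K : E → F} {θs : E} (hH : ∀ x, Continuous (H x))
    (hHK : Tendsto (fun x : X × E => H x.1 x.2 - K x.2) (𝓕 ×ˢ 𝓝 θs) (𝓝 0)) :
    ContinuousAt K θs := by
  rw [ContinuousAt, Metric.tendsto_nhds]
  intro ε hε
  have h := (Metric.tendsto_nhds.1 hHK (ε / 3) (by positivity)).curry
  -- The three-ε argument needs only one function uniformly close to `K` near `θs`.
  obtain ⟨x, hx⟩ := h.exists
  have hc := Metric.tendsto_nhds.1 ((hH x).tendsto θs) (ε / 3) (by positivity)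
  filter_upwards [hx, hc] with θ h1 h2
  have h3 := hx.self_of_nhds
  rw [dist_zero_right] at h1 h3
  rw [dist_eq_norm] at h2 ⊢
  calc ‖K θ - K θs‖ = ‖-(H x θ - K θ) + (H x θ - H x θs) + (H x θs - K θs)‖ := by
        congr 1; abel
    _ ≤ ‖H x θ - K θ‖ + ‖H x θ - H x θs‖ + ‖H x θs - K θs‖ := by
        refine (norm_add_le _ _).trans (add_le_add_left ((norm_add_le _ _).trans ?_) _)
        rw [norm_neg]
    _ < ε := by linarith

variable {Ω : Type*} [MeasurableSpace Ω] {P : Measure Ω} {p : ℕ} {θs : Param p} {δ : ℝ}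

/-- Smallness of the supremum is an event of high probability and the ball is a neighbourhood of its
centre, so together they give a product-filter limit. -/
lemma UnifTendstoInProb.tendsto_matNorm {A : ℕ → Ω → Param p → Matrix (Fin p) (Fin p) ℝ}
    {B : Param p → Matrix (Fin p) (Fin p) ℝ}
    (hU : UnifTendstoInProb P (Metric.closedBall θs δ) A B) (hδ : 0 < δ) :
    Tendsto (fun x : (ℕ × Ω) × Param p => matNorm (A x.1.1 x.1.2 x.2 - B x.2))
      (probFilter P atTop ×ˢ 𝓝 θs) (𝓝 0) := by
  rw [Metric.tendsto_nhds]
  intro ε hε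
  refine eventually_prod_iff.2 ⟨fun x => ⨆ θ ∈ Metric.closedBall θs δ,
    ENNReal.ofReal (matNorm (A x.1 x.2 θ - B θ)) < ENNReal.ofReal ε, ?_,
    fun θ => θ ∈ Metric.closedBall θs δ, Metric.closedBall_mem_nhds θs hδ, fun {x} hx {θ} hθ => ?_⟩
  · rw [eventually_probFilter]
    simpa only [not_lt] using hU (ENNReal.ofReal ε) (by simpa using hε)
  · have h1 : ENNReal.ofReal (matNorm (A x.1 x.2 θ - B θ)) < ENNReal.ofReal ε :=
      lt_of_le_of_lt (le_iSup₂ (f := fun θ (_ : θ ∈ Metric.closedBall θs δ) =>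
        ENNReal.ofReal (matNorm (A x.1 x.2 θ - B θ))) θ hθ) hx
    have h2 : 0 ≤ matNorm (A x.1 x.2 θ - B θ) := Real.sqrt_nonneg _
    rw [dist_zero_right, Real.norm_eq_abs, abs_of_nonneg h2]
    exact (ENNReal.ofReal_lt_ofReal_iff hε).1 h1

variable {S : Type*} [MeasurableSpace S] {ν : Measure S} {f : S → Param p → ℝ} {g h : S → ℝ}
  {Y Z : ℕ → Ω → S}

lemma tendsto_fderiv_gradient_logLik (hδ : 0 < δ) (hD_cont : ContinuousAt (matD ν f g) θs)
    (hU : UnifTendstoInProb P (Metric.closedBall θs δ)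
      (fun n ω => hess (logLik ν f n fun i => Y i ω)) (matD ν f g)) :
    Tendsto (fun x : (ℕ × Ω) × Param p =>
        fderiv ℝ (gradient (logLik ν f x.1.1 fun i => Y i x.1.2)) x.2)
      (probFilter P atTop ×ˢ 𝓝 θs)
      (𝓝 (Matrix.toEuclideanCLM (𝕜 := ℝ) (matD ν f g θs))) := by
  have h1 : Tendsto (fun x : (ℕ × Ω) × Param p =>
      fderiv ℝ (gradient (logLik ν f x.1.1 fun i => Y i x.1.2)) x.2 -
        Matrix.toEuclideanCLM (𝕜 := ℝ) (matD ν f g x.2)) (probFilter P atTop ×ˢ 𝓝 θs) (𝓝 0) :=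
    squeeze_zero_norm (fun x => norm_fderiv_gradient_sub_toEuclideanCLM_le _ _ _)
      (hU.tendsto_matNorm hδ)
  have hc : Continuous fun A : Matrix (Fin p) (Fin p) ℝ => Matrix.toEuclideanCLM (𝕜 := ℝ) A :=
    LinearMap.continuous_of_finiteDimensional
      ((Matrix.toEuclideanCLM (𝕜 := ℝ) (n := Fin p)).toAlgEquiv.toLinearMap)
  have h2 := (hc.continuousAt.tendsto.comp hD_cont.tendsto).comp
    (tendsto_snd (f := probFilter P (atTop : Filter ℕ)) (g := 𝓝 θs))
  simpa using h1.add h2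

variable [IsProbabilityMeasure P]

/-- The Hessians of C_m are continuous in θ, so their uniform limit ∇²C is continuous at `θs`. This
permits replacing the moving target ∇²C(θ) by its value at `θs`. -/
lemma tendsto_fderiv_gradient_mcConst (hδ : 0 < δ) (hf_smooth : ∀ y, ContDiff ℝ 2 (f y))
    (hU : UnifTendstoInProb P (Metric.closedBall θs δ)
      (fun m ω => hess (mcConst f h m fun k => Z k ω)) (hess (normConst ν f))) :
    ContinuousAt (fderiv ℝ (gradient (normConst ν f))) θs ∧
    Tendsto (fun x : (ℕ × Ω) × Param p =>
        fderiv ℝ (gradient (mcConst f h x.1.1 fun k => Z k x.1.2)) x.2)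
      (probFilter P atTop ×ˢ 𝓝 θs) (𝓝 (fderiv ℝ (gradient (normConst ν f)) θs)) := by
  have h1 : Tendsto (fun x : (ℕ × Ω) × Param p =>
      fderiv ℝ (gradient (mcConst f h x.1.1 fun k => Z k x.1.2)) x.2 -
        fderiv ℝ (gradient (normConst ν f)) x.2) (probFilter P atTop ×ˢ 𝓝 θs) (𝓝 0) :=
    squeeze_zero_norm (fun x => norm_fderiv_gradient_sub_le _ _ _) (hU.tendsto_matNorm hδ)
  have hcont : ∀ x : ℕ × Ω,
      Continuous (fderiv ℝ (gradient (mcConst f h x.1 fun k => Z k x.2))) := fun x => by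
    have h2 : ContDiff ℝ (1 + 1) (mcConst f h x.1 fun k => Z k x.2) := by
      rw [one_add_one_eq_two]
      exact contDiff_mcConst hf_smooth x.1 _
    exact (contDiff_gradient h2).continuous_fderiv (by norm_num)
  have hc : ContinuousAt (fderiv ℝ (gradient (normConst ν f))) θs :=
    continuousAt_of_tendsto_sub_prod hcont h1
  refine ⟨hc, ?_⟩
  have h2 := hc.tendsto.comp (tendsto_snd (f := probFilter P (atTop : Filter ℕ)) (g := 𝓝 θs))
  simpa using h1.add h2

end UniformLimits

/-! ### The mean score vanishes at the Kullback–Leibler projection -/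

section Score

lemma integrable_max_neg_natCast {S : Type*} [MeasurableSpace S] {μ : Measure S}
    [IsFiniteMeasure μ] {l : S → ℝ} (hl : Measurable l) (hpos : Integrable (fun y => max (l y) 0) μ)
    (M : ℕ) : Integrable (fun y => max (l y) (-(M : ℝ))) μ := by
  refine (hpos.add (integrable_const (M : ℝ))).mono'
    (hl.max measurable_const).aestronglyMeasurable (Eventually.of_forall fun y => ?_)
  have hM : (0 : ℝ) ≤ M := Nat.cast_nonneg M
  simp only [Real.norm_eq_abs, Pi.add_apply]
  rcases le_total (l y) (-(M : ℝ)) with h1 | h1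
  · rw [max_eq_right h1, abs_neg, abs_of_nonneg hM]
    exact le_add_of_nonneg_left (le_max_right _ _)
  · rw [max_eq_left h1, abs_le]
    exact ⟨by linarith [le_max_right (l y) 0], by linarith [le_max_left (l y) 0]⟩

/-- A function with integrable positive part whose truncations have integrals bounded below is
integrable. -/
lemma integrable_and_le_integral_of_forall_le {S : Type*} [MeasurableSpace S] {μ : Measure S}
    [IsFiniteMeasure μ] {l : S → ℝ} (hl : Measurable l) (hpos : Integrable (fun y => max (l y) 0) μ)
    {a : ℝ} (ha : ∀ M : ℕ, a ≤ ∫ y, max (l y) (-(M : ℝ)) ∂μ) :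
    Integrable l μ ∧ a ≤ ∫ y, l y ∂μ := by
  have htr : ∀ M : ℕ, Integrable (fun y => max (l y) (-(M : ℝ))) μ :=
    integrable_max_neg_natCast hl hpos
  have hlim : ∀ y, Tendsto (fun M : ℕ => max (l y) (-(M : ℝ))) atTop (𝓝 (l y)) := fun y => by
    refine tendsto_const_nhds.congr' ?_
    obtain ⟨N, hN⟩ := exists_nat_ge (-l y)
    filter_upwards [eventually_ge_atTop N] with M hM
    have : (N : ℝ) ≤ M := by exact_mod_cast hM
    rw [max_eq_left (by linarith)]
  have hneg : Integrable (fun y => max (l y) 0 - l y) μ := by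
    have hnn : ∀ y, 0 ≤ max (l y) 0 - l y := fun y => sub_nonneg.2 (le_max_left _ _)
    refine ⟨((hl.max measurable_const).sub hl).aestronglyMeasurable, ?_⟩
    rw [hasFiniteIntegral_iff_ofReal (Eventually.of_forall hnn)]
    -- The gaps increase with M to the negative part of l and their integrals are bounded, so
    -- monotone convergence makes the negative part integrable.
    have hconv : Tendsto (fun M : ℕ => ∫⁻ y, ENNReal.ofReal (max (l y) 0 - max (l y) (-(M : ℝ))) ∂μ)
        atTop (𝓝 (∫⁻ y, ENNReal.ofReal (max (l y) 0 - l y) ∂μ)) := by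
      refine lintegral_tendsto_of_tendsto_of_monotone (fun M => ?_)
        (Eventually.of_forall fun y => ?_) (Eventually.of_forall fun y => ?_)
      · exact ((hl.max measurable_const).sub
          (hl.max measurable_const)).ennreal_ofReal.aemeasurable
      · intro M N hMN
        have : (M : ℝ) ≤ N := by exact_mod_cast hMN
        refine ENNReal.ofReal_le_ofReal (sub_le_sub_left (max_le_max_left _ ?_) _)
        linarith
      · exact ENNReal.tendsto_ofReal ((hlim y).const_sub _)
    refine lt_of_le_of_lt (le_of_tendsto' hconv fun M => ?_)
      (ENNReal.ofReal_lt_top (r := ∫ y, max (l y) 0 ∂μ - a))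
    have hsub : Integrable (fun y => max (l y) 0 - max (l y) (-(M : ℝ))) μ := hpos.sub (htr M)
    rw [← ofReal_integral_eq_lintegral_ofReal hsub (Eventually.of_forall fun y =>
      sub_nonneg.2 (max_le_max_left _ (by simp)))]
    refine ENNReal.ofReal_le_ofReal ?_
    have h1 : ∫ y, (max (l y) 0 - max (l y) (-(M : ℝ))) ∂μ =
        ∫ y, max (l y) 0 ∂μ - ∫ y, max (l y) (-(M : ℝ)) ∂μ := integral_sub hpos (htr M)
    have h2 := ha M
    linarith
  have hint : Integrable l μ := (hpos.sub hneg).congr (Eventually.of_forall fun y => by simp)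
  refine ⟨hint, ge_of_tendsto' (tendsto_integral_of_dominated_convergence (fun y => |l y|)
    (fun M => (htr M).aestronglyMeasurable) hint.abs (fun M => Eventually.of_forall fun y => ?_)
    (Eventually.of_forall hlim)) ha⟩
  have hM : (0 : ℝ) ≤ M := Nat.cast_nonneg M
  rw [Real.norm_eq_abs]
  rcases le_total (l y) (-(M : ℝ)) with h1 | h1
  · rw [max_eq_right h1, abs_neg, abs_of_nonneg hM, abs_of_nonpos (by linarith)]
    linarith
  · rw [max_eq_left h1]

variable {Ω : Type*} [MeasurableSpace Ω] {P : Measure Ω} {p : ℕ} {θs : Param p}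
  {S : Type*} [MeasurableSpace S] {ν : Measure S} {f : S → Param p → ℝ} {g h : S → ℝ}
  {Y : ℕ → Ω → S} [IsProbabilityMeasure P]

lemma tendsto_gradient_logLik (hY : IsIIDSample P Y (law ν g))
    (hf_pos : ∀ᵐ y ∂(law ν g), ∀ θ, 0 < f y θ) (hf_smooth : ∀ y, ContDiff ℝ 2 (f y))
    (hf_diff : DiffUnderIntegral ν f) (hC : ∀ θ, 0 < normConst ν f θ)
    (hV : Integrable (fun y => gradient (logDensity ν f y) θs) (law ν g)) :
    Tendsto (fun x : ℕ × Ω => gradient (logLik ν f x.1 fun i => Y i x.2) θs) (probFilter P atTop)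
      (𝓝 (∫ y, gradient (logDensity ν f y) θs ∂(law ν g))) := by
  refine (hY.tendsto_average hV).congr' ?_
  have h := eventually_probFilter_of_ae (l := (atTop : Filter ℕ)) (hY.ae hf_pos)
  filter_upwards [h] with x hx
  exact (gradient_logLik hf_smooth hf_diff hC hx _ _).symm

/-- The likelihood increases in the direction of the mean score. -/
lemma exists_eventually_logLik_ge (hY : IsIIDSample P Y (law ν g))
    (hf_pos : ∀ᵐ y ∂(law ν g), ∀ θ, 0 < f y θ) (hf_smooth : ∀ y, ContDiff ℝ 2 (f y))
    (hf_diff : DiffUnderIntegral ν f) (hC : ∀ θ, 0 < normConst ν f θ)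
    (hV : Integrable (fun y => gradient (logDensity ν f y) θs) (law ν g))
    {L : Param p →L[ℝ] Param p}
    (hL : Tendsto (fun x : (ℕ × Ω) × Param p =>
        fderiv ℝ (gradient (logLik ν f x.1.1 fun i => Y i x.1.2)) x.2)
      (probFilter P atTop ×ˢ 𝓝 θs) (𝓝 L))
    (hs : ∫ y, gradient (logDensity ν f y) θs ∂(law ν g) ≠ 0) :
    ∃ θ, ∃ c : ℝ, 0 < c ∧ ∀ᶠ x : ℕ × Ω in probFilter P atTop,
      logLik ν f x.1 (fun i => Y i x.2) θs + c ≤ logLik ν f x.1 (fun i => Y i x.2) θ := by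
  set s := ∫ y, gradient (logDensity ν f y) θs ∂(law ν g) with hs_def
  have hgood := eventually_probFilter_of_ae (l := (atTop : Filter ℕ)) (hY.ae hf_pos)
  have htw : ∀ᶠ x : (ℕ × Ω) × Param p in probFilter P atTop ×ˢ 𝓝 θs,
      TwiceDiffAt (logLik ν f x.1.1 fun i => Y i x.1.2) x.2 := by
    filter_upwards [hgood.prod_inl (𝓝 θs)] with x hx
    exact twiceDiffAt_logLik hf_smooth hf_diff hC hx _ _
  have h1 := tendsto_prod_nhds_of_tendsto_fderiv
    (G := fun x : ℕ × Ω => gradient (logLik ν f x.1 fun i => Y i x.2))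
    (htw.mono fun x hx => hx.diff_gradient) hL
    (tendsto_gradient_logLik hY hf_pos hf_smooth hf_diff hC hV)
  have h2 : Tendsto (fun x : (ℕ × Ω) × Param p =>
      fderiv ℝ (logLik ν f x.1.1 fun i => Y i x.1.2) x.2) (probFilter P atTop ×ˢ 𝓝 θs)
      (𝓝 (InnerProductSpace.toDual ℝ (Param p) s)) := by
    have := ((InnerProductSpace.toDual ℝ (Param p)).continuous.tendsto s).comp h1
    refine this.congr fun x => ?_
    exact toDual_gradient
  have hs0 : 0 < ‖s‖ := norm_pos_iff.2 hs
  have h3 := eventually_norm_sub_sub_le_of_tendsto_fderiv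
    (G := fun x : ℕ × Ω => logLik ν f x.1 fun i => Y i x.2)
    (htw.mono fun x hx => hx.diff.self_of_nhds) h2 (half_pos hs0)
  -- Currying in this order allows one deterministic θ to be chosen, for which the expansion holds
  -- with probability tending to one.
  have h4 : ∀ᶠ θ in 𝓝 θs, ∀ᶠ x : ℕ × Ω in probFilter P atTop,
      ‖logLik ν f x.1 (fun i => Y i x.2) θ - logLik ν f x.1 (fun i => Y i x.2) θs -
        InnerProductSpace.toDual ℝ (Param p) s (θ - θs)‖ ≤ ‖s‖ / 2 * ‖θ - θs‖ :=
    (eventually_swap_iff.1 h3).curry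
  have h5 : Tendsto (fun r : ℝ => θs + r • s) (𝓝[>] 0) (𝓝 θs) := by
    have : Continuous fun r : ℝ => θs + r • s := by fun_prop
    simpa using (this.tendsto 0).mono_left nhdsWithin_le_nhds
  obtain ⟨r, hr, hr0⟩ := ((h5.eventually h4).and self_mem_nhdsWithin).exists
  have hr0 : 0 < r := hr0
  -- The linear gain is r‖s‖² and the expansion error is at most half of it.
  refine ⟨θs + r • s, r * ‖s‖ ^ 2 / 2, by positivity, ?_⟩
  filter_upwards [hr] with x hx
  rw [add_sub_cancel_left, norm_smul, Real.norm_of_nonneg hr0.le, map_smul,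
    InnerProductSpace.toDual_apply_apply, real_inner_self_eq_norm_sq, smul_eq_mul,
    Real.norm_eq_abs] at hx
  nlinarith [(abs_le.1 hx).1]

/-- No domination is available to differentiate E log p under the expectation. Instead, a nonzero
mean score makes the sample log-likelihood larger by a fixed c at some θ. The law of large numbers,
applied to log-densities truncated at −M since E log p(Y|θ) may be −∞, passes this gain to
expectations and contradicts maximality. -/
lemma integral_score_eq_zero (hf_meas : ∀ θ, Measurable fun y => f y θ) (hg : IsDensity ν g)
    (hθs : IsKLProjection ν f g θs) (hY : IsIIDSample P Y (law ν g))
    (hf_pos : ∀ᵐ y ∂(law ν g), ∀ θ, 0 < f y θ) (hf_smooth : ∀ y, ContDiff ℝ 2 (f y))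
    (hf_diff : DiffUnderIntegral ν f) (hC : ∀ θ, 0 < normConst ν f θ)
    (hV : Integrable (fun y => gradient (logDensity ν f y) θs) (law ν g))
    {L : Param p →L[ℝ] Param p}
    (hL : Tendsto (fun x : (ℕ × Ω) × Param p =>
        fderiv ℝ (gradient (logLik ν f x.1.1 fun i => Y i x.1.2)) x.2)
      (probFilter P atTop ×ˢ 𝓝 θs) (𝓝 L)) :
    ∫ y, gradient (logDensity ν f y) θs ∂(law ν g) = 0 := by
  have := hg.isProbabilityMeasure_law
  by_contra hs
  obtain ⟨θ, c, hc, hev⟩ := exists_eventually_logLik_ge hY hf_pos hf_smooth hf_diff hC hV hL hs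
  have hmeas : Measurable fun y => logDensity ν f y θ := ((hf_meas θ).log).sub_const _
  have hle : ∀ M : ℕ, (∫ y, logDensity ν f y θs ∂(law ν g)) + c ≤
      ∫ y, max (logDensity ν f y θ) (-(M : ℝ)) ∂(law ν g) := fun M => by
    have hint := integrable_max_neg_natCast hmeas (hθs.integrable_posPart θ) M
    refine le_of_tendsto_of_tendsto ((hY.tendsto_average hθs.integrable_at).add_const c)
      (hY.tendsto_average hint) ?_
    filter_upwards [hev] with x hx
    simp only [logLik_eq, one_div] at hx
    simp only [smul_eq_mul]
    refine hx.trans (mul_le_mul_of_nonneg_left (Finset.sum_le_sum fun i _ => le_max_left _ _) ?_)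
    positivity
  obtain ⟨hint, hge⟩ := integrable_and_le_integral_of_forall_le hmeas
    (hθs.integrable_posPart θ) hle
  linarith [hθs.le θ hint]

end Score

/-! ### Positive definiteness of W -/

section Covariance

variable {p : ℕ} {θs : Param p} {S : Type*} [MeasurableSpace S] {ν : Measure S}
  {f : S → Param p → ℝ} {g h : S → ℝ}

lemma posDef_of_quadForm_pos {A : Matrix (Fin p) (Fin p) ℝ} (hA : A.IsHermitian)
    (h : ∀ v : Param p, v ≠ 0 → 0 < quadForm A v) : A.PosDef := by
  refine Matrix.PosDef.of_dotProduct_mulVec_pos hA fun {x} hx => ?_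
  have := h (WithLp.toLp 2 x) (by simpa using hx)
  rw [quadForm_eq_dotProduct] at this
  simpa using this

lemma isHermitian_covMat {μ : Measure S} (X : S → Param p) : (covMat X μ).IsHermitian := by
  ext i j
  simp [covMat, covariance_comm]

lemma quadForm_matW [IsProbabilityMeasure (law ν h)] (hW : MemLp (mcScore ν f h θs) 2 (law ν h))
    (a : Param p) : quadForm (matW ν f h θs) a =
      1 / normConst ν f θs ^ 2 * Var[fun y => inner ℝ (mcScore ν f h θs y) a; law ν h] := by
  rw [matW, quadForm_smul, quadForm_covMat hW]

/-- Positive definiteness of `V` and the support condition on `h` force `W` to be positive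
definite. -/
lemma posDef_matW (hg : IsDensity ν g) (hh : IsDensity ν h)
    (hf_pos : ∀ᵐ y ∂(law ν g), ∀ θ, 0 < f y θ) (hf0 : ∀ᵐ y ∂ν, h y = 0 → f y = 0)
    (hf_smooth : ∀ y, ContDiff ℝ 2 (f y)) (hf_diff : DiffUnderIntegral ν f)
    (hC : ∀ θ, 0 < normConst ν f θ)
    (hV : MemLp (fun y => gradient (logDensity ν f y) θs) 2 (law ν g))
    (hW : MemLp (mcScore ν f h θs) 2 (law ν h)) (hV_pos : (matV ν f g θs).PosDef) :
    (matW ν f h θs).PosDef := by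
  have := hg.isProbabilityMeasure_law
  have := hh.isProbabilityMeasure_law
  refine posDef_of_quadForm_pos ((isHermitian_covMat _).smul (by simp [IsSelfAdjoint]))
    fun v hv => ?_
  rw [quadForm_matW hW]
  have hCs := hC θs
  refine mul_pos (by positivity) (lt_of_le_of_ne (variance_nonneg _ _) fun h0 => ?_)
  have hmean : ∫ y, inner ℝ (mcScore ν f h θs y) v ∂(law ν h) = 0 := by
    have h1 := integral_inner (𝕜 := ℝ) (hW.integrable one_le_two) v
    simp only [real_inner_comm] at h1 ⊢
    rw [h1, integral_mcScore hh hf0 hf_diff hCs, inner_zero_right]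
  have h1 := ae_eq_integral_of_variance_eq_zero (memLp_inner hW v) h0.symm
  rw [hmean] at h1
  have h2 := hh.ae_law_iff.1 h1
  have h3 := hg.ae_law_iff.1 hf_pos
  -- A null direction v of W gives ⟨∇f, v⟩ = f ⟨∇C, v⟩/C wherever h > 0. Where g > 0 one has f > 0
  -- and therefore h > 0, so dividing by f shows that the model score is degenerate in direction v
  -- too.
  have h4 : ∀ᵐ y ∂(law ν g), inner ℝ (gradient (logDensity ν f y) θs) v = 0 := by
    rw [hg.ae_law_iff]
    filter_upwards [h2, h3, hf0] with y hy2 hy3 hy0 hgy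
    have hfy := hy3 hgy
    have hhy : 0 < h y := by
      refine lt_of_le_of_ne (hh.nonneg y) fun hz => ?_
      have := hfy θs
      rw [hy0 hz.symm] at this
      exact lt_irrefl _ this
    have h5 := hy2 hhy
    rw [mcScore, inner_sub_left, real_inner_smul_left, real_inner_smul_left,
      real_inner_smul_left] at h5
    rw [gradient_logDensity hf_smooth hf_diff hC hfy, inner_sub_left, real_inner_smul_left,
      real_inner_smul_left]
    have hfy' := hfy θs
    have h6 : inner ℝ (gradient (f y) θs) v =
        f y θs * ((normConst ν f θs)⁻¹ * inner ℝ (gradient (normConst ν f) θs) v) := by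
      field_simp at h5 ⊢
      linarith
    rw [h6, inv_mul_cancel_left₀ hfy'.ne', sub_self]
  have h7 := hV_pos.quadForm_pos hv
  rw [matV, quadForm_covMat hV, variance_congr h4] at h7
  exact h7.ne' (variance_zero _)

end Covariance

/-! ### Two-sample central limit theorem at arbitrary rates -/

section TwoSample

lemma tendsto_fst_atTop_nat : Tendsto (Prod.fst : ℕ × ℕ → ℕ) atTop atTop := by
  rw [← prod_atTop_atTop_eq]
  exact tendsto_fst

lemma tendsto_snd_atTop_nat : Tendsto (Prod.snd : ℕ × ℕ → ℕ) atTop atTop := by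
  rw [← prod_atTop_atTop_eq]
  exact tendsto_snd

lemma eventually_atTop_pos : ∀ᶠ nm : ℕ × ℕ in atTop, 0 < nm.1 ∧ 0 < nm.2 :=
  (tendsto_fst_atTop_nat.eventually_gt_atTop 0).and (tendsto_snd_atTop_nat.eventually_gt_atTop 0)

variable {Ω S : Type*} [MeasurableSpace Ω] [MeasurableSpace S] {P : Measure Ω}
  {μ₁ μ₂ : Measure S} {Y Z : ℕ → Ω → S} {p : ℕ} {φ ψ : S → Param p}

/-- The matrix `V / n + W / m`. -/
noncomputable def pooledCov (V W : Matrix (Fin p) (Fin p) ℝ) (nm : ℕ × ℕ) :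
    Matrix (Fin p) (Fin p) ℝ :=
  (nm.1 : ℝ)⁻¹ • V + (nm.2 : ℝ)⁻¹ • W

/-- The operator `(V / n + W / m)^{-1/2}`. -/
noncomputable def pooledInvSqrt (V W : Matrix (Fin p) (Fin p) ℝ) (nm : ℕ × ℕ) :
    Param p →L[ℝ] Param p :=
  Matrix.toEuclideanCLM (𝕜 := ℝ) (invSqrt (pooledCov V W nm))

section Matrices

variable {V W : Matrix (Fin p) (Fin p) ℝ}

lemma posDef_pooledCov (hV : V.PosDef) (hW : W.PosDef) {nm : ℕ × ℕ} (h : 0 < nm.1 ∧ 0 < nm.2) :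
    (pooledCov V W nm).PosDef :=
  (hV.smul (inv_pos.2 (Nat.cast_pos.2 h.1))).add (hW.smul (inv_pos.2 (Nat.cast_pos.2 h.2)))

lemma quadForm_pooledCov (nm : ℕ × ℕ) (v : Param p) :
    quadForm (pooledCov V W nm) v = (nm.1 : ℝ)⁻¹ * quadForm V v + (nm.2 : ℝ)⁻¹ * quadForm W v := by
  rw [pooledCov, quadForm_add, quadForm_smul, quadForm_smul]

/-- With b = Σ^{-1/2}v, ‖v‖² is the sum of the forms of V/n and W/m at b. Keeping only the summand
of the smaller sample gives ‖v‖² ≥ e‖b‖²/min(n,m), where e bounds both forms from below. -/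
lemma exists_norm_pooledInvSqrt_le (hV : V.PosDef) (hW : W.PosDef) :
    ∃ K : ℝ, 0 ≤ K ∧ ∀ nm : ℕ × ℕ, 0 < nm.1 ∧ 0 < nm.2 → ∀ v : Param p,
      ‖pooledInvSqrt V W nm v‖ ≤ K * √(min nm.1 nm.2 : ℕ) * ‖v‖ := by
  obtain ⟨c, hc, hcV⟩ := hV.exists_le_quadForm
  obtain ⟨d, hd, hdW⟩ := hW.exists_le_quadForm
  set e := min c d with he
  have he0 : 0 < e := lt_min hc hd
  refine ⟨√e⁻¹, Real.sqrt_nonneg _, fun nm hnm v => ?_⟩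
  have h1 := quadForm_invSqrt (posDef_pooledCov hV hW hnm) v
  rw [quadForm_pooledCov] at h1
  change (nm.1 : ℝ)⁻¹ * quadForm V (pooledInvSqrt V W nm v) +
    (nm.2 : ℝ)⁻¹ * quadForm W (pooledInvSqrt V W nm v) = _ at h1
  set b := pooledInvSqrt V W nm v
  have hn : (0 : ℝ) < nm.1 := Nat.cast_pos.2 hnm.1
  have hm : (0 : ℝ) < nm.2 := Nat.cast_pos.2 hnm.2
  have h2 : e * ‖b‖ ^ 2 ≤ quadForm V b :=
    (mul_le_mul_of_nonneg_right (min_le_left _ _) (sq_nonneg _)).trans (hcV b)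
  have h3 : e * ‖b‖ ^ 2 ≤ quadForm W b :=
    (mul_le_mul_of_nonneg_right (min_le_right _ _) (sq_nonneg _)).trans (hdW b)
  have h0 : 0 ≤ e * ‖b‖ ^ 2 := by positivity
  have h4 : e * ‖b‖ ^ 2 ≤ (min nm.1 nm.2 : ℕ) * ‖v‖ ^ 2 := by
    rcases min_choice nm.1 nm.2 with h | h
    · rw [h, ← h1, mul_add, mul_inv_cancel_left₀ hn.ne']
      have : 0 ≤ (nm.1 : ℝ) * ((nm.2 : ℝ)⁻¹ * quadForm W b) := by
        have := h0.trans h3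
        positivity
      linarith
    · rw [h, ← h1, mul_add, mul_inv_cancel_left₀ hm.ne']
      have : 0 ≤ (nm.2 : ℝ) * ((nm.1 : ℝ)⁻¹ * quadForm V b) := by
        have := h0.trans h2
        positivity
      linarith
  rw [← Real.sqrt_mul (by positivity)]
  refine (Real.le_sqrt (norm_nonneg _) (by positivity)).2 ?_ |>.trans_eq
    (by rw [Real.sqrt_mul (by positivity), Real.sqrt_sq (norm_nonneg v)] :
      √(e⁻¹ * (min nm.1 nm.2 : ℕ) * ‖v‖ ^ 2) = _)
  rw [mul_assoc, ← div_eq_inv_mul, le_div_iff₀ he0, mul_comm]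
  exact h4

end Matrices

omit [MeasurableSpace Ω] in
lemma inv_smul_sum_eq (X : ℕ → Ω → Param p) (n : ℕ) (ω : Ω) :
    (n : ℝ)⁻¹ • ∑ k ∈ Finset.range n, X k ω = (√(n : ℝ))⁻¹ • normSum X n ω := by
  rw [normSum, smul_smul, ← mul_inv, Real.mul_self_sqrt (Nat.cast_nonneg n)]

/-- The two sums use disjoint blocks of the independent family indexed by ℕ ⊕ ℕ. -/
lemma indepFun_normSum (hY : IsIIDSample P Y μ₁) (hZ : IsIIDSample P Z μ₂)
    (h_indep : iIndepFun (fun s : ℕ ⊕ ℕ => Sum.elim Y Z s) P) (hφ : AEMeasurable φ μ₁)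
    (hψ : AEMeasurable ψ μ₂) (n m : ℕ) :
    IndepFun (normSum (fun i ω => φ (Y i ω)) n) (normSum (fun k ω => ψ (Z k ω)) m) P := by
  set X : ℕ ⊕ ℕ → Ω → Param p :=
    fun s => Sum.elim (fun _ : ℕ => φ) (fun _ : ℕ => ψ) s ∘ Sum.elim Y Z s with hX
  have hX_indep : iIndepFun X P := by
    refine h_indep.comp₀ (fun s => Sum.elim (fun _ : ℕ => φ) (fun _ : ℕ => ψ) s) ?_ ?_
    · rintro (i | k)
      · exact (hY.measurable i).aemeasurable
      · exact (hZ.measurable k).aemeasurable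
    · rintro (i | k)
      · simpa [hY.map_eq i] using hφ
      · simpa [hZ.map_eq k] using hψ
  have hX_meas : ∀ s, AEMeasurable (X s) P := by
    rintro (i | k)
    · exact hY.aemeasurable_comp hφ i
    · exact hZ.aemeasurable_comp hψ k
  have hdisj : Disjoint ((Finset.range n).map Function.Embedding.inl)
      ((Finset.range m).map (Function.Embedding.inr : ℕ ↪ ℕ ⊕ ℕ)) := by
    rw [Finset.disjoint_left]
    rintro s hs ht
    simp only [Finset.mem_map, Function.Embedding.inl_apply, Function.Embedding.inr_apply] at hs ht
    obtain ⟨i, -, rfl⟩ := hs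
    obtain ⟨k, -, hk⟩ := ht
    exact Sum.inr_ne_inl hk
  have h := hX_indep.indepFun_finset₀ _ _ hdisj hX_meas
  have hm : ∀ (T : Finset (ℕ ⊕ ℕ)) (c : ℝ),
      Measurable fun v : T → Param p => c • ∑ s, v s := fun T c =>
    (Finset.measurable_sum _ fun s _ => measurable_pi_apply s).const_smul c
  have h2 := h.comp (hm _ (√(n : ℝ))⁻¹) (hm _ (√(m : ℝ))⁻¹)
  convert! h2 using 1
  · ext1 ω
    simp only [Function.comp_apply, normSum]
    rw [Finset.sum_coe_sort _ fun s => X s ω, Finset.sum_map]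
    rfl
  · ext1 ω
    simp only [Function.comp_apply, normSum]
    rw [Finset.sum_coe_sort _ fun s => X s ω, Finset.sum_map]
    rfl

/-- The standardized difference of the sample means of `φ` and `ψ`. -/
noncomputable def standardizedDiff (φ ψ : S → Param p) (μ₁ μ₂ : Measure S) (Y Z : ℕ → Ω → S)
    (nm : ℕ × ℕ) (ω : Ω) : Param p :=
  pooledInvSqrt (covMat φ μ₁) (covMat ψ μ₂) nm
    ((nm.2 : ℝ)⁻¹ • ∑ k ∈ Finset.range nm.2, ψ (Z k ω) -
      (nm.1 : ℝ)⁻¹ • ∑ i ∈ Finset.range nm.1, φ (Y i ω))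

lemma aemeasurable_standardizedDiff (hY : IsIIDSample P Y μ₁) (hZ : IsIIDSample P Z μ₂)
    (hφ : AEMeasurable φ μ₁) (hψ : AEMeasurable ψ μ₂) (nm : ℕ × ℕ) :
    AEMeasurable (standardizedDiff φ ψ μ₁ μ₂ Y Z nm) P := by
  refine (ContinuousLinearMap.measurable _).comp_aemeasurable (AEMeasurable.sub ?_ ?_)
  · exact (Finset.aemeasurable_fun_sum _ fun k _ => hZ.aemeasurable_comp hψ k).const_smul
      (nm.2 : ℝ)⁻¹
  · exact (Finset.aemeasurable_fun_sum _ fun k _ => hY.aemeasurable_comp hφ k).const_smul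
      (nm.1 : ℝ)⁻¹

variable [IsProbabilityMeasure P]

/-- Symmetry of Σ^{-1/2} moves it onto t, and independence factorizes. -/
lemma charFun_standardizedDiff (hY : IsIIDSample P Y μ₁) (hZ : IsIIDSample P Z μ₂)
    (h_indep : iIndepFun (fun s : ℕ ⊕ ℕ => Sum.elim Y Z s) P)
    (hφ : MemLp φ 2 μ₁) (hψ : MemLp ψ 2 μ₂) (nm : ℕ × ℕ) (t : Param p) :
    charFun (P.map (standardizedDiff φ ψ μ₁ μ₂ Y Z nm)) t =
      charFun (P.map (normSum (fun i ω => φ (Y i ω)) nm.1))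
        (-(√(nm.1 : ℝ))⁻¹ • pooledInvSqrt (covMat φ μ₁) (covMat ψ μ₂) nm t) *
      charFun (P.map (normSum (fun k ω => ψ (Z k ω)) nm.2))
        ((√(nm.2 : ℝ))⁻¹ • pooledInvSqrt (covMat φ μ₁) (covMat ψ μ₂) nm t) := by
  have hφm := hφ.aestronglyMeasurable.aemeasurable
  have hψm := hψ.aestronglyMeasurable.aemeasurable
  have hA := aemeasurable_normSum (hY.aemeasurable_comp hφm) nm.1
  have hB := aemeasurable_normSum (hZ.aemeasurable_comp hψm) nm.2
  set A := normSum (fun i ω => φ (Y i ω)) nm.1 with hAdef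
  set B := normSum (fun k ω => ψ (Z k ω)) nm.2 with hBdef
  set b := pooledInvSqrt (covMat φ μ₁) (covMat ψ μ₂) nm t with hb
  have hind : IndepFun (fun ω => -(√(nm.1 : ℝ))⁻¹ • A ω) (fun ω => (√(nm.2 : ℝ))⁻¹ • B ω) P :=
    (indepFun_normSum hY hZ h_indep hφm hψm nm.1 nm.2).comp
      (measurable_const_smul (-(√(nm.1 : ℝ))⁻¹)) (measurable_const_smul (√(nm.2 : ℝ))⁻¹)
  have hA' : AEMeasurable (fun ω => -(√(nm.1 : ℝ))⁻¹ • A ω) P :=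
    hA.const_smul (-(√(nm.1 : ℝ))⁻¹)
  have hB' : AEMeasurable (fun ω => (√(nm.2 : ℝ))⁻¹ • B ω) P := hB.const_smul (√(nm.2 : ℝ))⁻¹
  have hAB : AEMeasurable (fun ω => -(√(nm.1 : ℝ))⁻¹ • A ω + (√(nm.2 : ℝ))⁻¹ • B ω) P :=
    hA'.add hB'
  rw [← charFun_map_smul_comp hA, ← charFun_map_smul_comp hB, ← Pi.mul_apply,
    ← hind.charFun_map_fun_add_eq_mul hA' hB',
    charFun_map_eq (aemeasurable_standardizedDiff hY hZ hφm hψm nm),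
    charFun_map_eq hAB]
  refine integral_congr_ae (Eventually.of_forall fun ω => ?_)
  have h1 : inner ℝ (standardizedDiff φ ψ μ₁ μ₂ Y Z nm ω) t =
      inner ℝ (-(√(nm.1 : ℝ))⁻¹ • A ω + (√(nm.2 : ℝ))⁻¹ • B ω) b := by
    rw [standardizedDiff, pooledInvSqrt, inner_invSqrt_left,
      inv_smul_sum_eq (fun i ω => φ (Y i ω)), inv_smul_sum_eq (fun k ω => ψ (Z k ω)), neg_smul,
      neg_add_eq_sub]
    rfl
  simp only [h1]

variable [IsProbabilityMeasure μ₁] [IsProbabilityMeasure μ₂]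

/-- A two-sample central limit theorem, with sample sizes tending to infinity at arbitrary rates. -/
theorem tendstoInDistribution_standardizedDiff (hY : IsIIDSample P Y μ₁)
    (hZ : IsIIDSample P Z μ₂) (h_indep : iIndepFun (fun s : ℕ ⊕ ℕ => Sum.elim Y Z s) P)
    (hφ : MemLp φ 2 μ₁) (hψ : MemLp ψ 2 μ₂) (hφ0 : ∫ y, φ y ∂μ₁ = 0) (hψ0 : ∫ y, ψ y ∂μ₂ = 0)
    (hV : (covMat φ μ₁).PosDef) (hW : (covMat ψ μ₂).PosDef) :
    TendstoInDistribution (standardizedDiff φ ψ μ₁ μ₂ Y Z) atTop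
      (id : Param p → Param p) (fun _ => P) (stdGaussian (Param p)) := by
  have hφm := hφ.aestronglyMeasurable.aemeasurable
  have hψm := hψ.aestronglyMeasurable.aemeasurable
  have hmeas := aemeasurable_standardizedDiff hY hZ hφm hψm
  have hchar : ∀ t : Param p, Tendsto (fun nm =>
      charFun (P.map (standardizedDiff φ ψ μ₁ μ₂ Y Z nm)) t) atTop
      (𝓝 (Complex.exp (-(‖t‖ : ℂ) ^ 2 / 2))) := fun t => by
    obtain ⟨K, hK0, hK⟩ := exists_norm_pooledInvSqrt_le hV hW
    set b := fun nm => pooledInvSqrt (covMat φ μ₁) (covMat ψ μ₂) nm t with hb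
    set b₁ := fun nm : ℕ × ℕ => -(√(nm.1 : ℝ))⁻¹ • b nm with hb₁
    set b₂ := fun nm : ℕ × ℕ => (√(nm.2 : ℝ))⁻¹ • b nm with hb₂
    have hbd : ∀ (k j : ℕ), 0 < k → j ≤ k → ∀ x : ℝ, x ≤ K * √(j : ℝ) * ‖t‖ →
        (√(k : ℝ))⁻¹ * x ≤ K * ‖t‖ := fun k j hk hjk x hx => by
      have hk' : 0 < √(k : ℝ) := Real.sqrt_pos.2 (Nat.cast_pos.2 hk)
      rw [← div_eq_inv_mul, div_le_iff₀ hk']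
      have : √(j : ℝ) ≤ √(k : ℝ) := Real.sqrt_le_sqrt (by exact_mod_cast hjk)
      calc x ≤ K * √(j : ℝ) * ‖t‖ := hx
        _ ≤ K * √(k : ℝ) * ‖t‖ := by gcongr
        _ = K * ‖t‖ * √(k : ℝ) := by ring
    have hb₁_le : ∀ᶠ nm in atTop, ‖b₁ nm‖ ≤ K * ‖t‖ := by
      filter_upwards [eventually_atTop_pos] with nm hnm
      rw [hb₁, norm_smul, norm_neg, norm_inv, Real.norm_of_nonneg (Real.sqrt_nonneg _)]
      exact hbd _ _ hnm.1 (min_le_left _ _) _ (hK nm hnm t)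
    have hb₂_le : ∀ᶠ nm in atTop, ‖b₂ nm‖ ≤ K * ‖t‖ := by
      filter_upwards [eventually_atTop_pos] with nm hnm
      rw [hb₂, norm_smul, norm_inv, Real.norm_of_nonneg (Real.sqrt_nonneg _)]
      exact hbd _ _ hnm.2 (min_le_right _ _) _ (hK nm hnm t)
    have h1 := hY.tendsto_charFun_normSum_sub hφ hφ0 tendsto_fst_atTop_nat hb₁_le
    have h2 := hZ.tendsto_charFun_normSum_sub hψ hψ0 tendsto_snd_atTop_nat hb₂_le
    set α := fun nm : ℕ × ℕ => charFun (P.map (normSum (fun i ω => φ (Y i ω)) nm.1)) (b₁ nm)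
    set β := fun nm : ℕ × ℕ => charFun (P.map (normSum (fun i ω => ψ (Z i ω)) nm.2)) (b₂ nm)
    set e₁ := fun nm : ℕ × ℕ => Complex.exp (-(quadForm (covMat φ μ₁) (b₁ nm) : ℝ) / 2)
    set e₂ := fun nm : ℕ × ℕ => Complex.exp (-(quadForm (covMat ψ μ₂) (b₂ nm) : ℝ) / 2)
    have hβ : ∀ nm, ‖β nm‖ ≤ 1 := fun nm => by
      have := Measure.isProbabilityMeasure_map (μ := P)
        (aemeasurable_normSum (hZ.aemeasurable_comp hψm) nm.2)
      exact norm_charFun_le_one _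
    have he₁ : ∀ nm, ‖e₁ nm‖ ≤ 1 := fun nm => by
      rw [Complex.norm_exp, Real.exp_le_one_iff]
      have h3 : 0 ≤ quadForm (covMat φ μ₁) (b₁ nm) := by
        rw [quadForm_covMat hφ]
        exact variance_nonneg _ _
      have h4 : (-(quadForm (covMat φ μ₁) (b₁ nm) : ℂ) / 2) =
          ((-quadForm (covMat φ μ₁) (b₁ nm) / 2 : ℝ) : ℂ) := by push_cast; rfl
      rw [h4, Complex.ofReal_re]
      linarith
    have h3 : Tendsto (fun nm => α nm * β nm - e₁ nm * e₂ nm) atTop (𝓝 0) := by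
      refine squeeze_zero_norm (a := fun nm => ‖α nm - e₁ nm‖ + ‖β nm - e₂ nm‖) (fun nm => ?_)
        (by simpa using h1.norm.add h2.norm)
      have : α nm * β nm - e₁ nm * e₂ nm =
          (α nm - e₁ nm) * β nm + e₁ nm * (β nm - e₂ nm) := by ring
      rw [this]
      refine (norm_add_le _ _).trans (add_le_add ?_ ?_)
      · rw [norm_mul]
        exact mul_le_of_le_one_right (norm_nonneg _) (hβ nm)
      · rw [norm_mul]
        exact mul_le_of_le_one_left (norm_nonneg _) (he₁ nm)
    -- The Gaussian exponents add up to the form of Σ at Σ^{-1/2}t, which is ‖t‖² for every n, m >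
    -- 0. Hence no limit of n/m is needed.
    have h4 : ∀ᶠ nm in atTop, e₁ nm * e₂ nm = Complex.exp (-(‖t‖ : ℂ) ^ 2 / 2) := by
      filter_upwards [eventually_atTop_pos] with nm hnm
      have h5 := quadForm_invSqrt (posDef_pooledCov hV hW hnm) t
      rw [quadForm_pooledCov] at h5
      change (nm.1 : ℝ)⁻¹ * quadForm (covMat φ μ₁) (b nm) +
        (nm.2 : ℝ)⁻¹ * quadForm (covMat ψ μ₂) (b nm) = _ at h5
      have h6 : quadForm (covMat φ μ₁) (b₁ nm) + quadForm (covMat ψ μ₂) (b₂ nm) = ‖t‖ ^ 2 := by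
        rw [hb₁, hb₂, quadForm_smul_right, quadForm_smul_right, neg_sq, inv_pow, inv_pow,
          Real.sq_sqrt (Nat.cast_nonneg _), Real.sq_sqrt (Nat.cast_nonneg _), h5]
      rw [← Complex.exp_add]
      congr 1
      rw [← Complex.ofReal_pow, ← h6]
      push_cast
      ring
    have h5 := h3.add (tendsto_const_nhds.congr' (h4.mono fun _ h => h.symm))
    rw [zero_add] at h5
    refine h5.congr fun nm => ?_
    rw [sub_add_cancel, charFun_standardizedDiff hY hZ h_indep hφ hψ]
  -- Lévy's continuity theorem is applied along every sequence of pairs (n, m) tending to infinity.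
  refine ⟨hmeas, by fun_prop, tendsto_of_seq_tendsto fun u hu => ?_⟩
  refine ProbabilityMeasure.tendsto_iff_tendsto_charFun.2 fun t => ?_
  simp only [ProbabilityMeasure.coe_mk, Measure.map_id, charFun_stdGaussian]
  exact (hchar t).comp hu

end TwoSample

/-! ### Gradient and Hessian of the Monte Carlo log-likelihood -/

section Estimator

variable {S : Type*} [MeasurableSpace S] {ν : Measure S} {Ω : Type*} [MeasurableSpace Ω]
  {P : Measure Ω} {p : ℕ} {f : S → Param p → ℝ} {g h : S → ℝ} {θs : Param p}
  {Y Z : ℕ → Ω → S}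

/-- The normalized Monte Carlo score, with covariance matrix `W`. -/
noncomputable def scaledMcScore (ν : Measure S) (f : S → Param p → ℝ) (h : S → ℝ) (θ : Param p)
    (y : S) : Param p :=
  (normConst ν f θ)⁻¹ • mcScore ν f h θ y

lemma covMat_scaledMcScore (μ : Measure S) : covMat (scaledMcScore ν f h θs) μ =
    (1 / normConst ν f θs ^ 2) • covMat (mcScore ν f h θs) μ := by
  ext i j
  simp only [covMat, scaledMcScore, Matrix.of_apply, PiLp.smul_apply, smul_eq_mul,
    Matrix.smul_apply]
  rw [covariance_const_mul_left, covariance_const_mul_right]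
  ring

/-- The gradient of the Monte Carlo log-likelihood, in terms of the two averaged scores. -/
lemma gradient_mcLogLik (hf_smooth : ∀ y, ContDiff ℝ 2 (f y))
    (hf_diff : DiffUnderIntegral ν f) (hC : ∀ θ, 0 < normConst ν f θ) {y z : ℕ → S}
    (hy : ∀ i θ, 0 < f (y i) θ) {n m : ℕ} (hn : n ≠ 0) (hCm : mcConst f h m z θs ≠ 0) :
    gradient (mcLogLik f h n m y z) θs =
      (n : ℝ)⁻¹ • ∑ i ∈ Finset.range n, gradient (logDensity ν f (y i)) θs -
      (normConst ν f θs / mcConst f h m z θs) •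
        ((m : ℝ)⁻¹ • ∑ k ∈ Finset.range m, scaledMcScore ν f h θs (z k)) := by
  have h1 : (m : ℝ)⁻¹ • ∑ k ∈ Finset.range m, scaledMcScore ν f h θs (z k) =
      (normConst ν f θs)⁻¹ • (gradient (mcConst f h m z) θs -
        mcConst f h m z θs • ((normConst ν f θs)⁻¹ • gradient (normConst ν f) θs)) := by
    rw [← average_mcScore hf_smooth, smul_comm]
    simp only [scaledMcScore, Finset.smul_sum]
  have hCs := (hC θs).ne'
  rw [mcLogLik_eq hn (ν := ν) m y z, ((twiceDiffAt_logLik hf_smooth hf_diff hC hy n θs).hasGradientAt.add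
    (((hf_diff.twiceDiffAt θs).hasGradientAt.log hCs).sub
      ((twiceDiffAt_of_contDiff (contDiff_mcConst hf_smooth m z)).hasGradientAt.log hCm))).gradient,
    gradient_logLik hf_smooth hf_diff hC hy, h1, add_sub_assoc', sub_eq_sub_iff_add_eq_add]
  have h2 : (normConst ν f θs / mcConst f h m z θs) * (normConst ν f θs)⁻¹ =
      (mcConst f h m z θs)⁻¹ := by field_simp
  rw [smul_smul, h2, smul_sub, smul_smul, inv_mul_cancel₀ hCm, one_smul]
  abel

lemma tendsto_fst_probFilter :
    Tendsto (fun x : (ℕ × ℕ) × Ω => (x.1.1, x.2)) (probFilter P atTop) (probFilter P atTop) :=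
  tendsto_map_probFilter tendsto_fst_atTop_nat

lemma tendsto_snd_probFilter :
    Tendsto (fun x : (ℕ × ℕ) × Ω => (x.1.2, x.2)) (probFilter P atTop) (probFilter P atTop) :=
  tendsto_map_probFilter tendsto_snd_atTop_nat

variable [IsProbabilityMeasure P]

lemma tendsto_mcConst (hh : IsDensity ν h) (hZ : IsIIDSample P Z (law ν h))
    (hf0 : ∀ᵐ y ∂ν, h y = 0 → f y = 0) (hf_diff : DiffUnderIntegral ν f) :
    Tendsto (fun x : ℕ × Ω => mcConst f h x.1 (fun k => Z k x.2) θs) (probFilter P atTop)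
      (𝓝 (normConst ν f θs)) := by
  have h1 := hZ.tendsto_average (integrable_mcRatio hh hf0 hf_diff θs)
  rw [integral_mcRatio hh hf0] at h1
  exact h1.congr fun x => (mcConst_eq _ _ _).symm

lemma tendsto_gradient_mcConst (hh : IsDensity ν h) (hZ : IsIIDSample P Z (law ν h))
    (hf0 : ∀ᵐ y ∂ν, h y = 0 → f y = 0) (hf_smooth : ∀ y, ContDiff ℝ 2 (f y))
    (hf_diff : DiffUnderIntegral ν f) :
    Tendsto (fun x : ℕ × Ω => gradient (mcConst f h x.1 fun k => Z k x.2) θs) (probFilter P atTop)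
      (𝓝 (gradient (normConst ν f) θs)) := by
  have h1 := hZ.tendsto_average (integrable_importance hh (ae_gradient_eq_zero hf0 θs)
    (hf_diff.integrable_gradient θs))
  rw [integral_importance hh (ae_gradient_eq_zero hf0 θs),
    ← (hf_diff.hasGradientAt θs).gradient] at h1
  exact h1.congr fun x => (gradient_mcConst hf_smooth _ _ _).symm

/-- The Hessians of log C and log C_m have the same limit near `θs`, because value, gradient and
Hessian of C_m all converge and C is nonzero there. Their difference disappears, leaving the limit
for the exact log-likelihood. -/
lemma eventually_twiceDiffAt_and_tendsto_mcLogLik (hh : IsDensity ν h)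
    (hY : IsIIDSample P Y (law ν g)) (hZ : IsIIDSample P Z (law ν h))
    (hf_pos : ∀ᵐ y ∂(law ν g), ∀ θ, 0 < f y θ) (hf0 : ∀ᵐ y ∂ν, h y = 0 → f y = 0)
    (hf_smooth : ∀ y, ContDiff ℝ 2 (f y)) (hf_diff : DiffUnderIntegral ν f)
    (hC : ∀ θ, 0 < normConst ν f θ) {L : Param p →L[ℝ] Param p}
    (hL : Tendsto (fun x : (ℕ × Ω) × Param p =>
        fderiv ℝ (gradient (logLik ν f x.1.1 fun i => Y i x.1.2)) x.2)
      (probFilter P atTop ×ˢ 𝓝 θs) (𝓝 L))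
    (hCc : ContinuousAt (fderiv ℝ (gradient (normConst ν f))) θs)
    (hCm : Tendsto (fun x : (ℕ × Ω) × Param p =>
        fderiv ℝ (gradient (mcConst f h x.1.1 fun k => Z k x.1.2)) x.2)
      (probFilter P atTop ×ˢ 𝓝 θs) (𝓝 (fderiv ℝ (gradient (normConst ν f)) θs))) :
    (∀ᶠ x : ((ℕ × ℕ) × Ω) × Param p in probFilter P atTop ×ˢ 𝓝 θs,
      TwiceDiffAt (mcLogLik f h x.1.1.1 x.1.1.2 (fun i => Y i x.1.2) fun k => Z k x.1.2) x.2) ∧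
    Tendsto (fun x : ((ℕ × ℕ) × Ω) × Param p => fderiv ℝ (gradient
        (mcLogLik f h x.1.1.1 x.1.1.2 (fun i => Y i x.1.2) fun k => Z k x.1.2)) x.2)
      (probFilter P atTop ×ˢ 𝓝 θs) (𝓝 L) := by
  have hCm_tw : ∀ (x : ℕ × Ω) θ, TwiceDiffAt (mcConst f h x.1 fun k => Z k x.2) θ := fun x θ =>
    twiceDiffAt_of_contDiff (contDiff_mcConst hf_smooth _ _)
  have hg1 := tendsto_prod_nhds_of_tendsto_fderiv
    (G := fun x : ℕ × Ω => gradient (mcConst f h x.1 fun k => Z k x.2))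
    (Eventually.of_forall fun x => (hCm_tw x.1 x.2).diff_gradient) hCm
    (tendsto_gradient_mcConst hh hZ hf0 hf_smooth hf_diff)
  have hg2 : Tendsto (fun x : (ℕ × Ω) × Param p =>
      fderiv ℝ (mcConst f h x.1.1 fun k => Z k x.1.2) x.2) (probFilter P atTop ×ˢ 𝓝 θs)
      (𝓝 (InnerProductSpace.toDual ℝ (Param p) (gradient (normConst ν f) θs))) := by
    refine (((InnerProductSpace.toDual ℝ (Param p)).continuous.tendsto _).comp hg1).congr
      fun x => ?_
    exact toDual_gradient
  have hg3 := tendsto_prod_nhds_of_tendsto_fderiv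
    (G := fun x : ℕ × Ω => mcConst f h x.1 fun k => Z k x.2)
    (Eventually.of_forall fun x => (hCm_tw x.1 x.2).diff.self_of_nhds) hg2
    (tendsto_mcConst hh hZ hf0 hf_diff)
  have hCs : normConst ν f θs ≠ 0 := (hC θs).ne'
  set T := fderiv ℝ (gradient (normConst ν f)) θs
  have hl1 : Tendsto (fun x : (ℕ × Ω) × Param p =>
      logHess (mcConst f h x.1.1 (fun k => Z k x.1.2) x.2,
        gradient (mcConst f h x.1.1 fun k => Z k x.1.2) x.2,
        fderiv ℝ (gradient (mcConst f h x.1.1 fun k => Z k x.1.2)) x.2))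
      (probFilter P atTop ×ˢ 𝓝 θs)
      (𝓝 (logHess (normConst ν f θs, gradient (normConst ν f) θs, T))) :=
    (continuousAt_logHess (x := (normConst ν f θs, gradient (normConst ν f) θs, T)) hCs).tendsto.comp
      (hg3.prodMk_nhds (hg1.prodMk_nhds hCm))
  have hl2 : Tendsto (fun θ => logHess (normConst ν f θ, gradient (normConst ν f) θ,
      fderiv ℝ (gradient (normConst ν f)) θ)) (𝓝 θs)
      (𝓝 (logHess (normConst ν f θs, gradient (normConst ν f) θs, T))) := by
    have h1 := (hf_diff.twiceDiffAt θs).diff.self_of_nhds.continuousAt.tendsto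
    have h2 := (hf_diff.twiceDiffAt θs).diff_gradient.continuousAt.tendsto
    exact (continuousAt_logHess (x := (normConst ν f θs, gradient (normConst ν f) θs, T)) hCs).tendsto.comp
      (h1.prodMk_nhds (h2.prodMk_nhds hCc))
  have hfst : Tendsto (fun x : ((ℕ × ℕ) × Ω) × Param p => ((x.1.1.1, x.1.2), x.2))
      (probFilter P atTop ×ˢ 𝓝 θs) (probFilter P atTop ×ˢ 𝓝 θs) :=
    tendsto_fst_probFilter.prodMap tendsto_id
  have hsnd : Tendsto (fun x : ((ℕ × ℕ) × Ω) × Param p => ((x.1.1.2, x.1.2), x.2))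
      (probFilter P atTop ×ˢ 𝓝 θs) (probFilter P atTop ×ˢ 𝓝 θs) :=
    tendsto_snd_probFilter.prodMap tendsto_id
  have hgood : ∀ᶠ x : ((ℕ × ℕ) × Ω) × Param p in probFilter P atTop ×ˢ 𝓝 θs,
      ∀ i θ, 0 < f (Y i x.1.2) θ :=
    (eventually_probFilter_of_ae (hY.ae hf_pos)).prod_inl (𝓝 θs)
  have hpos : ∀ᶠ x : ((ℕ × ℕ) × Ω) × Param p in probFilter P atTop ×ˢ 𝓝 θs,
      0 < x.1.1.1 ∧ 0 < x.1.1.2 :=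
    (tendsto_fst_probFilter_index.eventually eventually_atTop_pos).prod_inl (𝓝 θs)
  have hne : ∀ᶠ x : ((ℕ × ℕ) × Ω) × Param p in probFilter P atTop ×ˢ 𝓝 θs,
      mcConst f h x.1.1.2 (fun k => Z k x.1.2) x.2 ≠ 0 :=
    hsnd.eventually (hg3.eventually_ne hCs)
  refine ⟨?_, ?_⟩
  · filter_upwards [hgood, hpos, hne] with x hx1 hx2 hx3
    rw [mcLogLik_eq hx2.1.ne' (ν := ν)]
    exact (twiceDiffAt_logLik hf_smooth hf_diff hC hx1 _ _).add
      (((hf_diff.twiceDiffAt _).log (hC _).ne').sub ((hCm_tw (x.1.1.2, x.1.2) _).log hx3))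
  · have hlim := (hL.comp hfst).add
      ((hl2.comp (tendsto_snd (f := probFilter P (atTop : Filter (ℕ × ℕ))))).sub (hl1.comp hsnd))
    rw [sub_self, add_zero] at hlim
    refine hlim.congr' ?_
    filter_upwards [hgood, hpos, hne] with x hx1 hx2 hx3
    rw [mcLogLik_eq hx2.1.ne' (ν := ν)]
    have t1 := twiceDiffAt_logLik hf_smooth hf_diff hC hx1 x.1.1.1 x.2
    have t2 := hf_diff.twiceDiffAt x.2
    have t3 := hCm_tw (x.1.1.2, x.1.2) x.2
    rw [t1.fderiv_gradient_add ((t2.log (hC _).ne').sub (t3.log hx3)),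
      (t2.log (hC _).ne').fderiv_gradient_sub (t3.log hx3),
      (t2.hasFDerivAt_gradient_log (hC _).ne').fderiv, (t3.hasFDerivAt_gradient_log hx3).fderiv]
    rfl

end Estimator

/-! ### Consistency and negligible remainders -/

section Rate

variable {Ω : Type*} [MeasurableSpace Ω] {P : Measure Ω} {p : ℕ} {θs : Param p}
  {θhat : ℕ → ℕ → Ω → Param p}

lemma BoundedInProb.tightAlong_norm
    (h_rate : BoundedInProb P fun nm ω => √(min nm.1 nm.2 : ℕ) • (θhat nm.1 nm.2 ω - θs)) :
    TightAlong P atTop fun (nm : ℕ × ℕ) ω => √(min nm.1 nm.2 : ℕ) * ‖θhat nm.1 nm.2 ω - θs‖ := by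
  intro ε hε
  obtain ⟨M, hM⟩ := h_rate ε hε
  refine ⟨M, hM.mono fun nm h => ?_⟩
  simpa only [norm_smul, Real.norm_of_nonneg (Real.sqrt_nonneg _)] using h

lemma tendsto_sqrt_min : Tendsto (fun nm : ℕ × ℕ => √((min nm.1 nm.2 : ℕ) : ℝ)) atTop atTop := by
  refine Real.tendsto_sqrt_atTop.comp (tendsto_natCast_atTop_atTop.comp ?_)
  rw [tendsto_atTop]
  intro b
  filter_upwards [tendsto_fst_atTop_nat.eventually_ge_atTop b,
    tendsto_snd_atTop_nat.eventually_ge_atTop b] with nm h1 h2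
  exact le_min h1 h2

/-- The error is a bounded-in-probability quantity divided by √min(n,m). -/
lemma tendsto_estimator
    (h_tight : TightAlong P atTop fun (nm : ℕ × ℕ) ω =>
      √(min nm.1 nm.2 : ℕ) * ‖θhat nm.1 nm.2 ω - θs‖) :
    Tendsto (fun x : (ℕ × ℕ) × Ω => θhat x.1.1 x.1.2 x.2) (probFilter P atTop) (𝓝 θs) := by
  have h1 : Tendsto (fun x : (ℕ × ℕ) × Ω => (√((min x.1.1 x.1.2 : ℕ) : ℝ))⁻¹)
      (probFilter P atTop) (𝓝 0) :=
    (tendsto_inv_atTop_zero.comp tendsto_sqrt_min).comp tendsto_fst_probFilter_index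
  have h2 := h_tight.tendsto_mul (fun _ _ => by positivity) h1
  rw [tendsto_iff_norm_sub_tendsto_zero]
  refine h2.congr' ?_
  filter_upwards [tendsto_fst_probFilter_index.eventually
    (tendsto_sqrt_min.eventually_gt_atTop 0)] with x hx
  exact inv_mul_cancel_left₀ hx.ne' _

end Rate

/-- A vector remainder that is negligible relative to the estimation error stays negligible after
standardization. -/
lemma tendsto_standardized_remainder {Ω : Type*} [MeasurableSpace Ω] {P : Measure Ω} {p : ℕ}
    {V W : Matrix (Fin p) (Fin p) ℝ} (hV : V.PosDef) (hW : W.PosDef)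
    {θhat : ℕ → ℕ → Ω → Param p} {θs : Param p} {R : (ℕ × ℕ) × Ω → Param p}
    (h_tight : TightAlong P atTop fun (nm : ℕ × ℕ) ω =>
      √(min nm.1 nm.2 : ℕ) * ‖θhat nm.1 nm.2 ω - θs‖)
    (hR : ∀ ε > 0, ∀ᶠ x in probFilter P atTop, ‖R x‖ ≤ ε * ‖θhat x.1.1 x.1.2 x.2 - θs‖) :
    Tendsto (fun x => pooledInvSqrt V W x.1 (R x)) (probFilter P atTop) (𝓝 0) := by
  obtain ⟨K, hK0, hK⟩ := exists_norm_pooledInvSqrt_le hV hW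
  -- When θ̂ = `θs` this quotient is 0 by convention; the bound on `R` then forces R = 0, so R still
  -- has norm e · ‖θ̂ − `θs`‖.
  set e : (ℕ × ℕ) × Ω → ℝ := fun x => ‖R x‖ / ‖θhat x.1.1 x.1.2 x.2 - θs‖ with he
  have he_lim : Tendsto e (probFilter P atTop) (𝓝 0) := by
    rw [Metric.tendsto_nhds]
    intro ε hε
    filter_upwards [hR (ε / 2) (by positivity)] with x hx
    have h0 : 0 ≤ e x := by positivity
    rw [dist_zero_right, Real.norm_of_nonneg h0]
    have : e x ≤ ε / 2 := div_le_of_le_mul₀ (norm_nonneg _) (by positivity) hx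
    linarith
  have h1 := (h_tight.tendsto_mul (fun _ _ => by positivity) he_lim).const_mul K
  rw [mul_zero] at h1
  refine squeeze_zero_norm' ?_ h1
  filter_upwards [hR 1 one_pos, tendsto_fst_probFilter_index.eventually eventually_atTop_pos]
    with x hx hpos
  refine (hK x.1 hpos (R x)).trans_eq ?_
  have h2 : ‖R x‖ = e x * ‖θhat x.1.1 x.1.2 x.2 - θs‖ := by
    by_cases h0 : ‖θhat x.1.1 x.1.2 x.2 - θs‖ = 0
    · rw [h0, mul_zero] at hx ⊢
      exact le_antisymm hx (norm_nonneg _)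
    · rw [he, div_mul_cancel₀ _ h0]
  rw [h2]
  ring

/-- Replacing the exact norming constant by its Monte Carlo approximation in the Monte Carlo score
has a negligible effect after standardization. -/
lemma tendsto_standardized_ratio {Ω : Type*} [MeasurableSpace Ω] {P : Measure Ω} {p : ℕ}
    {V W : Matrix (Fin p) (Fin p) ℝ} (hV : V.PosDef) (hW : W.PosDef) {X : ℕ → Ω → Param p}
    (hX : TightAlong P atTop fun m ω => ‖normSum X m ω‖) {a : (ℕ × ℕ) × Ω → ℝ}
    (ha : Tendsto a (probFilter P atTop) (𝓝 0)) :
    Tendsto (fun x : (ℕ × ℕ) × Ω => pooledInvSqrt V W x.1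
        (a x • ((x.1.2 : ℝ)⁻¹ • ∑ k ∈ Finset.range x.1.2, X k x.2)))
      (probFilter P atTop) (𝓝 0) := by
  obtain ⟨K, hK0, hK⟩ := exists_norm_pooledInvSqrt_le hV hW
  have ha' : Tendsto (fun x => |a x|) (probFilter P atTop) (𝓝 0) := by simpa using ha.abs
  have h1 := ((hX.comp tendsto_snd_atTop_nat).tendsto_mul (fun _ _ => norm_nonneg _)
    ha').const_mul K
  rw [mul_zero] at h1
  refine squeeze_zero_norm' ?_ h1
  filter_upwards [tendsto_fst_probFilter_index.eventually eventually_atTop_pos] with x hpos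
  refine (hK x.1 hpos _).trans ?_
  rw [inv_smul_sum_eq, norm_smul, norm_smul, Real.norm_eq_abs, norm_inv,
    Real.norm_of_nonneg (Real.sqrt_nonneg _)]
  have hm : 0 < √(x.1.2 : ℝ) := Real.sqrt_pos.2 (Nat.cast_pos.2 hpos.2)
  have hle : √((min x.1.1 x.1.2 : ℕ) : ℝ) ≤ √(x.1.2 : ℝ) :=
    Real.sqrt_le_sqrt (by exact_mod_cast min_le_right _ _)
  -- The growth √min(n,m) of Σ^{-1/2} is absorbed by the factor 1/√m of the average.
  have h2 : √((min x.1.1 x.1.2 : ℕ) : ℝ) * (√(x.1.2 : ℝ))⁻¹ ≤ 1 := by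
    rw [← div_eq_mul_inv, div_le_one hm]
    exact hle
  calc K * √((min x.1.1 x.1.2 : ℕ) : ℝ) * (|a x| * ((√(x.1.2 : ℝ))⁻¹ * ‖normSum X x.1.2 x.2‖))
      = (√((min x.1.1 x.1.2 : ℕ) : ℝ) * (√(x.1.2 : ℝ))⁻¹) *
          (K * (|a x| * ‖normSum X x.1.2 x.2‖)) := by ring
    _ ≤ K * (|a x| * ‖normSum X x.1.2 x.2‖) := mul_le_of_le_one_left (by positivity) h2

end MCML

/-! ### Assembly: Taylor expansion and Slutsky's lemma -/

theorem theorem1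
    -- data space with dominating measure, and the underlying probability space
    {S : Type*} [MeasurableSpace S] (ν : Measure S) [SigmaFinite ν]
    {Ω : Type*} [MeasurableSpace Ω] (P : Measure Ω) [IsProbabilityMeasure P]
    {p : ℕ}
    -- unnormalized model density, true density, instrumental density, target parameter
    (f : S → MCML.Param p → ℝ) (g h : S → ℝ) (θs : MCML.Param p)
    (hf_meas : ∀ θ, Measurable fun y => f y θ)
    (hf_nonneg : ∀ y θ, 0 ≤ f y θ)
    (hg : MCML.IsDensity ν g) (hh : MCML.IsDensity ν h)
    (hf_pos : ∀ᵐ y ∂(MCML.law ν g), ∀ θ, 0 < f y θ)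
    (hh_supp : ∀ θ, ∀ᵐ y ∂ν, h y = 0 → f y θ = 0)
    (hθs : MCML.IsKLProjection ν f g θs)
    -- the observations, the Monte Carlo sample, and the estimator
    (Y Z : ℕ → Ω → S)
    (hY_meas : ∀ i, Measurable (Y i)) (hZ_meas : ∀ k, Measurable (Z k))
    (hY_law : ∀ i, P.map (Y i) = MCML.law ν g)
    (hZ_law : ∀ k, P.map (Z k) = MCML.law ν h)
    (h_indep : iIndepFun (fun s : ℕ ⊕ ℕ => Sum.elim Y Z s) P)
    (θhat : ℕ → ℕ → Ω → MCML.Param p)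
    (hθhat_meas : ∀ n m, AEMeasurable (θhat n m) P)
    (hθhat_max : Tendsto
      (fun nm : ℕ × ℕ => P {ω | ¬ IsMaxOn
        (MCML.mcLogLik f h nm.1 nm.2 (fun i => Y i ω) (fun k => Z k ω))
        Set.univ (θhat nm.1 nm.2 ω)})
      atTop (𝓝 0))
    -- the neighbourhood `U` is the closed ball of radius `δ` around `θs`
    (δ : ℝ) (hδ : 0 < δ)
    -- smoothness, and derivatives pass under the integral sign
    (hf_smooth : ∀ y, ContDiff ℝ 2 (f y))
    (hf_diff : MCML.DiffUnderIntegral ν f)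
    -- root-`min(n,m)` consistency
    (h_rate : MCML.BoundedInProb P fun nm ω =>
      √(min nm.1 nm.2 : ℕ) • (θhat nm.1 nm.2 ω - θs))
    -- `V`, `D(θ)` and `W` exist
    (hV_exists : MemLp (fun y => gradient (MCML.logDensity ν f y) θs) 2 (MCML.law ν g))
    (hD_exists : ∀ θ ∈ Metric.closedBall θs δ, ∀ i j,
      Integrable (fun y => MCML.hess (MCML.logDensity ν f y) θ i j) (MCML.law ν g))
    (hW_exists : MemLp (MCML.mcScore ν f h θs) 2 (MCML.law ν h))
    (hV_pos : (MCML.matV ν f g θs).PosDef)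
    (hD_neg : (-MCML.matD ν f g θs).PosDef)
    (hD_cont : ContinuousAt (MCML.matD ν f g) θs)
    -- uniform convergence of the Hessians on `U`
    (h_unif_lik : MCML.UnifTendstoInProb P (Metric.closedBall θs δ)
      (fun n ω => MCML.hess (MCML.logLik ν f n fun i => Y i ω))
      (MCML.matD ν f g))
    (h_unif_const : MCML.UnifTendstoInProb P (Metric.closedBall θs δ)
      (fun m ω => MCML.hess (MCML.mcConst f h m fun k => Z k ω))
      (MCML.hess (MCML.normConst ν f))) :
    TendstoInDistribution
      (fun (nm : ℕ × ℕ) ω =>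
        Matrix.toEuclideanLin
          (MCML.invSqrt ((nm.1 : ℝ)⁻¹ • MCML.matV ν f g θs + (nm.2 : ℝ)⁻¹ • MCML.matW ν f h θs) *
            MCML.matD ν f g θs)
          (θhat nm.1 nm.2 ω - θs))
      atTop (id : MCML.Param p → MCML.Param p) (fun _ => P) (stdGaussian (MCML.Param p)) := by
  have hμg := hg.isProbabilityMeasure_law
  have hμh := hh.isProbabilityMeasure_law
  have hY : MCML.IsIIDSample P Y (MCML.law ν g) :=
    ⟨hY_meas, hY_law, iIndepFun.precomp (g := Sum.inl) Sum.inl_injective h_indep⟩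
  have hZ : MCML.IsIIDSample P Z (MCML.law ν h) :=
    ⟨hZ_meas, hZ_law, iIndepFun.precomp (g := Sum.inr) Sum.inr_injective h_indep⟩
  have hC := MCML.normConst_pos hf_nonneg hg hf_pos hf_diff
  have hf0 := MCML.ae_eq_zero_of_instrumental_eq_zero hf_smooth hh_supp
  have hL := MCML.tendsto_fderiv_gradient_logLik hδ hD_cont h_unif_lik
  obtain ⟨hCc, hCm⟩ := MCML.tendsto_fderiv_gradient_mcConst hδ hf_smooth h_unif_const
  have hscore := MCML.integral_score_eq_zero hf_meas hg hθs hY hf_pos hf_smooth hf_diff hC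
    (hV_exists.integrable one_le_two) hL
  have hW_pos := MCML.posDef_matW hg hh hf_pos hf0 hf_smooth hf_diff hC hV_exists hW_exists hV_pos
  have hψ : MemLp (MCML.scaledMcScore ν f h θs) 2 (MCML.law ν h) := hW_exists.const_smul (MCML.normConst ν f θs)⁻¹
  have hψ0 : ∫ y, MCML.scaledMcScore ν f h θs y ∂(MCML.law ν h) = 0 := by
    unfold MCML.scaledMcScore
    rw [integral_smul, MCML.integral_mcScore hh hf0 hf_diff (hC θs), smul_zero]
  have hWeq : MCML.covMat (MCML.scaledMcScore ν f h θs) (MCML.law ν h) = MCML.matW ν f h θs :=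
    MCML.covMat_scaledMcScore _
  have hclt := MCML.tendstoInDistribution_standardizedDiff hY hZ h_indep hV_exists hψ hscore hψ0
    hV_pos (by rwa [hWeq])
  have h_tight := h_rate.tightAlong_norm
  have hcons := MCML.tendsto_estimator h_tight
  obtain ⟨htw, hlim⟩ := MCML.eventually_twiceDiffAt_and_tendsto_mcLogLik hh hY hZ hf_pos hf0
    hf_smooth hf_diff hC hL hCc hCm
  set V := MCML.matV ν f g θs with hVdef
  set W := MCML.matW ν f h θs with hWdef
  set Dop := Matrix.toEuclideanCLM (𝕜 := ℝ) (MCML.matD ν f g θs) with hDop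
  set F : (ℕ × ℕ) × Ω → MCML.Param p → ℝ := fun x =>
    MCML.mcLogLik f h x.1.1 x.1.2 (fun i => Y i x.2) (fun k => Z k x.2) with hF
  set R : (ℕ × ℕ) × Ω → MCML.Param p := fun x =>
    gradient (F x) (θhat x.1.1 x.1.2 x.2) - gradient (F x) θs -
      Dop (θhat x.1.1 x.1.2 x.2 - θs) with hRdef
  -- The expansion is uniform in θ near `θs`, so by consistency the random θ̂ may be substituted for
  -- θ.
  have hR : ∀ ε > 0, ∀ᶠ x in MCML.probFilter P atTop,
      ‖R x‖ ≤ ε * ‖θhat x.1.1 x.1.2 x.2 - θs‖ := fun ε hε =>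
    (tendsto_id.prodMk hcons).eventually (MCML.eventually_norm_sub_sub_le_of_tendsto_fderiv
      (G := fun x => gradient (F x)) (htw.mono fun x hx => hx.diff_gradient) hlim hε)
  have hrem1 := MCML.tendsto_standardized_remainder hV_pos hW_pos h_tight hR
  have hCmlim := (MCML.tendsto_mcConst (θs := θs) hh hZ hf0 hf_diff).comp
    MCML.tendsto_snd_probFilter
  have ha : Tendsto (fun x : (ℕ × ℕ) × Ω => MCML.normConst ν f θs /
      MCML.mcConst f h x.1.2 (fun k => Z k x.2) θs - 1) (MCML.probFilter P atTop) (𝓝 0) := by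
    have h1 := (tendsto_const_nhds (x := MCML.normConst ν f θs)).div hCmlim (hC θs).ne'
    rw [div_self (hC θs).ne'] at h1
    simpa using h1.sub_const 1
  have hrem2 := MCML.tendsto_standardized_ratio hV_pos hW_pos
    (hZ.tightAlong_norm_normSum hψ hψ0) ha
  have hrem := hrem2.sub hrem1
  rw [sub_zero] at hrem
  set T : ℕ × ℕ → Ω → MCML.Param p := fun nm ω => Matrix.toEuclideanLin
      (MCML.invSqrt ((nm.1 : ℝ)⁻¹ • V + (nm.2 : ℝ)⁻¹ • W) * MCML.matD ν f g θs)
      (θhat nm.1 nm.2 ω - θs) with hT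
  set T₀ : ℕ × ℕ → Ω → MCML.Param p :=
    MCML.standardizedDiff (fun y => gradient (MCML.logDensity ν f y) θs)
      (MCML.scaledMcScore ν f h θs) (MCML.law ν g) (MCML.law ν h) Y Z with hT₀
  have hmeas : ∀ nm : ℕ × ℕ, AEMeasurable (T nm) P := fun nm =>
    (LinearMap.continuous_of_finiteDimensional _).measurable.comp_aemeasurable
      ((hθhat_meas nm.1 nm.2).sub_const θs)
  -- Slutsky: the statistic differs from the standardized difference of averages by the two
  -- remainders, from C/C_m − 1 and from the Taylor expansion.
  suffices hdiff : Tendsto (fun x : (ℕ × ℕ) × Ω => (T - T₀) x.1 x.2) (MCML.probFilter P atTop)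
      (𝓝 0) from
    tendstoInDistribution_of_tendstoInMeasure_sub T id hclt
      ((MCML.tendsto_probFilter_iff (X := T - T₀) (l := atTop)).1 hdiff) hmeas
  refine hrem.congr' ?_
  have hmax : ∀ᶠ x in MCML.probFilter P (atTop : Filter (ℕ × ℕ)),
      IsMaxOn (F x) Set.univ (θhat x.1.1 x.1.2 x.2) := hθhat_max
  filter_upwards [hmax, hCmlim.eventually_ne (hC θs).ne',
    MCML.tendsto_fst_probFilter_index.eventually MCML.eventually_atTop_pos,
    MCML.eventually_probFilter_of_ae (hY.ae hf_pos)] with x hx1 hx2 hx3 hx4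
  have h1 := MCML.gradient_mcLogLik (z := fun k => Z k x.2) (m := x.1.2) hf_smooth hf_diff hC hx4
    hx3.1.ne' hx2
  have h2 : R x = -gradient (F x) θs - Dop (θhat x.1.1 x.1.2 x.2 - θs) := by
    rw [hRdef]
    simp only [hx1.gradient_eq_zero, zero_sub]
  have h3 : T x.1 x.2 = MCML.pooledInvSqrt V W x.1 (Dop (θhat x.1.1 x.1.2 x.2 - θs)) := by
    simp only [hT]
    rw [← Matrix.coe_toEuclideanCLM_eq_toEuclideanLin, map_mul]
    rfl
  have h4 : Dop (θhat x.1.1 x.1.2 x.2 - θs) = -gradient (F x) θs - R x := by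
    rw [h2]
    abel
  have h5 : gradient (F x) θs = _ := h1
  simp only [Pi.sub_apply]
  have hVeq : MCML.covMat (fun y => gradient (MCML.logDensity ν f y) θs) (MCML.law ν g) = V := rfl
  rw [h3, h4, h5, hT₀, MCML.standardizedDiff, hVeq, hWeq, ← map_sub, ← map_sub]
  congr 1
  rw [sub_smul, one_smul]
  abel
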